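/- Let $\mathcal A$ be a small abelian category which is finitary (all $\mathrm{Hom}(M,N)$ and $\mathrm{Ext}^1(M,N)$ are finite), hereditary ($\mathrm{Ext}^i=0$ for $i\ge 2$) and in which every object has only finitely many subobjects. Let $K(\mathcal A)$ be its Grothendieck group, and write $\overline M\in K(\mathcal A)$ for the class of an object $M$. Fix a bimultiplicative square root of the Euler form, i.e. a bimultiplicative map $\langle\,,\rangle_m:K(\mathcal A)\times K(\mathcal A)\to\mathbb C^\times$ with $\langle \overline M,\overline N\rangle_m^2=|\mathrm{Hom}(M,N)|/|\mathrm{Ext}^1(M,N)|$ (for instance, the positive square root), and put $(\alpha,\beta)_m=\langle\alpha,\beta\rangle_m\langle\beta,\alpha\rangle_m$. Objects are identified with their classes inside these forms. Put $a_M=|\mathrm{Aut}(M)|$ and let $\mathbf P^R_{M,N}$ be the number of short exact sequences $0\to N\to R\to M\to 0$ (pairs of morphisms). The extended Hall algebra $\widetilde{\mathbf H}_{\mathcal A}$ is the complex vector space with basis $[M]\mathbf k_\alpha$, where $M$ runs over isomorphism classes of objects and $\alpha$ over $K(\mathcal A)$. Write $[M]=[M]\mathbf k_0$, $\mathbf k_\alpha=[0]\mathbf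 k_\alpha$ and $\mathbf k_M=\mathbf k_{\overline M}$. Its product $m$, unit $i$, coproduct $\Delta$ and counit $\epsilon$ are $$[M]\mathbf k_\alpha\cdot[N]\mathbf k_\beta=(\alpha,N)_m\langle M,N\rangle_m\sum_R\frac{\mathbf P^R_{M,N}}{a_Ma_N}[R]\mathbf k_{\alpha+\beta},\qquad i(c)=c\,[0]\mathbf k_0,$$ $$\Delta([R]\mathbf k_\alpha)=\sum_{M,N}\langle M,N\rangle_m\frac{\mathbf P^R_{M,N}}{a_R}\,[M]\mathbf k_{\overline N+\alpha}\otimes[N]\mathbf k_\alpha,\qquad \epsilon([M]\mathbf k_\alpha)=\delta_{M,0}.$$ Define a linear map $S:\widetilde{\mathbf H}_{\mathcal A}\to\widetilde{\mathbf H}_{\mathcal A}$ by $S([M]\mathbf k_\alpha)=\mathbf k_\alpha^{-1}S([M])$ and $$S([M])=\mathbf k_M^{-1}\sum_{r}(-1)^r\sum_{L_\bullet}\ \prod_{i=1}^r\langle L_i/L_{i+1},L_{i+1}\rangle_m\ \frac{\prod_{i=1}^r a_{L_i/L_{i+1}}}{a_M}\ [L_1/L_2]\cdot[L_2/L_3]\cdots[L_r/L_{r+1}],$$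 where $L_\bullet$ runs over the strict filtrations $0=L_{r+1}\subsetneq L_r\subsetneq\cdots\subsetneq L_2\subsetneq L_1=M$ ($r\ge1$ if $M\ne0$; for $M=0$ only the empty filtration with $r=0$ occurs, so that $S([0])=[0]$). Theorem (Xiao). All the sums above are finite: for given $M,N$ there are finitely many isomorphism classes $R$ with $\mathbf P^R_{M,N}\ne0$; for given $R$ there are finitely many pairs $(M,N)$ with $\mathbf P^R_{M,N}\neq0$; and every object has finitely many strict filtrations. Moreover, $S$ is an antipode for $\widetilde{\mathbf H}_{\mathcal A}$, that is, $$m\circ(1\otimes S)\circ\Delta=i\circ\epsilon=m\circ(S\otimes1)\circ\Delta,$$ $$S(xy)=S(y)S(x),\qquad \Delta\circ S=(S\otimes S)\circ\Delta^{op},\qquad S\circ i=i,\qquad \epsilon\circ S=\epsilon,$$ and $(\widetilde{\mathbf H}_{\mathcal A},m,i,\Delta,\epsilon,S)$ is a Hopf algebra over $\mathbb C$. -/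

import Mathlib

open CategoryTheory CategoryTheory.Limits
open scoped TensorProduct ZeroObject

universe w v u

noncomputable section

namespace HallAlg

/-! ### Conditions on an abelian category -/

section Conditions

variable (C : Type u) [Category.{v} C] [Abelian C]

/-- An abelian category is finitary if all `Hom` and all `Ext¹` groups are finite. -/
structure IsFinitary [HasExt.{w} C] : Prop where
  finite_hom : ∀ M N : C, Finite (M ⟶ N)
  finite_ext : ∀ M N : C, Finite (Abelian.Ext.{w} M N 1)

/-- Hereditary: global dimension at most one, i.e. `Extⁱ = 0` for all `i ≥ 2`. -/
def IsHereditary [HasExt.{w} C] : Prop :=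
  ∀ (M N : C) (i : ℕ), 2 ≤ i → Subsingleton (Abelian.Ext.{w} M N i)

/-- The finite subobjects condition: each object has only finitely many subobjects. -/
def FiniteSubobjects : Prop :=
  ∀ M : C, Finite (Subobject M)

/-! ### The Grothendieck group -/

/-- The relations `[X₂] = [X₁] + [X₃]`, one for each short exact sequence
`0 ⟶ X₁ ⟶ X₂ ⟶ X₃ ⟶ 0`. -/
def k0Relations : Set (FreeAbelianGroup C) :=
  { x | ∃ S : ShortComplex C, S.ShortExact ∧
      x = FreeAbelianGroup.of S.X₂ - (FreeAbelianGroup.of S.X₁ + FreeAbelianGroup.of S.X₃) }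

/-- The Grothendieck group `K(C)`. -/
abbrev K0 : Type u := FreeAbelianGroup C ⧸ AddSubgroup.closure (k0Relations C)

variable {C}

/-- The class of an object in the Grothendieck group. -/
def k0Class (M : C) : K0 C :=
  QuotientAddGroup.mk (FreeAbelianGroup.of M)

end Conditions

variable {C : Type u} [Category.{v} C] [Abelian C]

/-! ### The multiplicative Euler form -/

/-- The multiplicative Euler form involves the choice of a square root: a `EulerRoot` is a
bimultiplicative form `⟨ , ⟩ₘ : K(C) × K(C) → ℂˣ` with
`⟨M, N⟩ₘ² = ∏ᵢ |Extⁱ(M, N)|^((-1)ⁱ)`, which for hereditary `C` is `|Hom(M, N)| / |Ext¹(M, N)|`.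
The form given by the positive square root is constructed in `EulerRoot.positive` below. -/
structure EulerRoot (C : Type u) [Category.{v} C] [Abelian C] [HasExt.{w} C] where
  form : K0 C →+ K0 C →+ Additive ℂˣ
  form_sq : ∀ M N : C,
    (((form (k0Class M) (k0Class N)).toMul : ℂˣ) : ℂ) ^ 2 =
      (Nat.card (M ⟶ N) : ℂ) / (Nat.card (Abelian.Ext.{w} M N 1) : ℂ)

/-- Lift a function on objects that is additive on short exact sequences to `K(C)`. -/
def k0Lift {G : Type*} [AddCommGroup G] (φ : C → G)
    (hφ : ∀ S : ShortComplex C, S.ShortExact → φ S.X₂ = φ S.X₁ + φ S.X₃) : K0 C →+ G :=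
  QuotientAddGroup.lift _ (FreeAbelianGroup.lift φ) (by
    rw [AddSubgroup.closure_le]
    rintro x ⟨S, hS, rfl⟩
    simp [hφ S hS])

lemma k0Lift_k0Class {G : Type*} [AddCommGroup G] (φ : C → G)
    (hφ : ∀ S : ShortComplex C, S.ShortExact → φ S.X₂ = φ S.X₁ + φ S.X₃) (M : C) :
    k0Lift φ hφ (k0Class M) = φ M :=
  FreeAbelianGroup.lift_apply_of φ M

lemma k0_hom_ext {G : Type*} [AddCommGroup G] {f g : K0 C →+ G}
    (h : ∀ M : C, f (k0Class M) = g (k0Class M)) : f = g := by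
  apply QuotientAddGroup.addMonoidHom_ext
  apply FreeAbelianGroup.lift_ext
  exact h

lemma card_eq_ker_mul_range {A B : Type*} [AddCommGroup A] [AddCommGroup B] (f : A →+ B) :
    Nat.card A = Nat.card f.ker * Nat.card f.range := by
  rw [AddSubgroup.card_eq_card_quotient_mul_card_addSubgroup f.ker, mul_comm,
    Nat.card_congr (QuotientAddGroup.quotientKerEquivRange f).toEquiv]

lemma card_sixTerm {A₁ A₂ A₃ A₄ A₅ A₆ : Type*} [AddCommGroup A₁] [AddCommGroup A₂]
    [AddCommGroup A₃] [AddCommGroup A₄] [AddCommGroup A₅] [AddCommGroup A₆]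
    (f₁ : A₁ →+ A₂) (f₂ : A₂ →+ A₃) (f₃ : A₃ →+ A₄) (f₄ : A₄ →+ A₅) (f₅ : A₅ →+ A₆)
    (h₁ : Function.Injective f₁) (e₂ : f₁.range = f₂.ker) (e₃ : f₂.range = f₃.ker)
    (e₄ : f₃.range = f₄.ker) (e₅ : f₄.range = f₅.ker) (h₅ : Function.Surjective f₅) :
    Nat.card A₂ * Nat.card A₄ * Nat.card A₆ = Nat.card A₁ * Nat.card A₃ * Nat.card A₅ := by
  have r₁ : Nat.card A₁ = Nat.card f₁.range :=
    Nat.card_congr (AddMonoidHom.ofInjective h₁).toEquiv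
  have r₅ : Nat.card A₆ = Nat.card f₅.range := by
    rw [AddMonoidHom.range_eq_top.mpr h₅, AddSubgroup.card_top]
  rw [r₁, r₅, card_eq_ker_mul_range f₂, card_eq_ker_mul_range f₃, card_eq_ker_mul_range f₄,
    card_eq_ker_mul_range f₅, e₂, e₃, e₄, e₅]
  ring

section Positive

variable [HasExt.{w} C]

lemma card_ext_zero (M N : C) : Nat.card (Abelian.Ext.{w} M N 0) = Nat.card (M ⟶ N) :=
  Nat.card_congr Abelian.Ext.homEquiv₀

lemma range_eq_ker {A B D : AddCommGrpCat.{w}} (f : A ⟶ B) (g : B ⟶ D) (z : f ≫ g = 0)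
    (h : (ShortComplex.mk f g z).Exact) : f.hom.range = g.hom.ker := by
  rw [ShortComplex.ab_exact_iff_range_eq_ker] at h
  exact h

lemma card_covariant (hher : IsHereditary.{w} C) (M : C) (S : ShortComplex C)
    (hS : S.ShortExact) :
    Nat.card (M ⟶ S.X₂) * Nat.card (Abelian.Ext.{w} M S.X₁ 1) *
        Nat.card (Abelian.Ext.{w} M S.X₃ 1) =
      Nat.card (M ⟶ S.X₁) * Nat.card (M ⟶ S.X₃) * Nat.card (Abelian.Ext.{w} M S.X₂ 1) := by
  rw [← card_ext_zero.{w} M S.X₁, ← card_ext_zero.{w} M S.X₂, ← card_ext_zero.{w} M S.X₃]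
  have := hS.mono_f
  refine card_sixTerm _ _ _ _ _
    (Abelian.Ext.postcomp_mk₀_injective_of_mono M S.f)
    (range_eq_ker _ _ _ (Abelian.Ext.covariant_sequence_exact₂' M hS 0))
    (range_eq_ker _ _ _ (Abelian.Ext.covariant_sequence_exact₃' M hS 0 1 rfl))
    (range_eq_ker _ _ _ (Abelian.Ext.covariant_sequence_exact₁' M hS 0 1 rfl))
    (range_eq_ker _ _ _ (Abelian.Ext.covariant_sequence_exact₂' M hS 1)) ?_
  intro x
  have := hher M S.X₁ 2 le_rfl
  exact Abelian.Ext.covariant_sequence_exact₃ M hS x rfl (Subsingleton.elim _ _)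

lemma card_contravariant (hher : IsHereditary.{w} C) (N : C) (S : ShortComplex C)
    (hS : S.ShortExact) :
    Nat.card (S.X₂ ⟶ N) * Nat.card (Abelian.Ext.{w} S.X₃ N 1) *
        Nat.card (Abelian.Ext.{w} S.X₁ N 1) =
      Nat.card (S.X₃ ⟶ N) * Nat.card (S.X₁ ⟶ N) * Nat.card (Abelian.Ext.{w} S.X₂ N 1) := by
  rw [← card_ext_zero.{w} S.X₁ N, ← card_ext_zero.{w} S.X₂ N, ← card_ext_zero.{w} S.X₃ N]
  have := hS.epi_g
  refine card_sixTerm _ _ _ _ _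
    (Abelian.Ext.precomp_mk₀_injective_of_epi N S.g)
    (range_eq_ker _ _ _ (Abelian.Ext.contravariant_sequence_exact₂' hS N 0))
    (range_eq_ker _ _ _ (Abelian.Ext.contravariant_sequence_exact₁' hS N 0 1 rfl))
    (range_eq_ker _ _ _ (Abelian.Ext.contravariant_sequence_exact₃' hS N 0 1 rfl))
    (range_eq_ker _ _ _ (Abelian.Ext.contravariant_sequence_exact₂' hS N 1)) ?_
  intro x
  have := hher S.X₃ N 2 le_rfl
  exact Abelian.Ext.contravariant_sequence_exact₁ hS N x rfl (Subsingleton.elim _ _)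

/-- `|Hom(M, N)| / |Ext¹(M, N)|` -/
def eulerRatio (M N : C) : ℝ :=
  (Nat.card (M ⟶ N) : ℝ) / (Nat.card (Abelian.Ext.{w} M N 1) : ℝ)

lemma card_hom_pos (hfin : IsFinitary.{w} C) (M N : C) : 0 < (Nat.card (M ⟶ N) : ℝ) := by
  have := hfin.finite_hom M N
  exact_mod_cast Nat.card_pos

lemma card_ext_pos (hfin : IsFinitary.{w} C) (M N : C) :
    0 < (Nat.card (Abelian.Ext.{w} M N 1) : ℝ) := by
  have := hfin.finite_ext M N
  exact_mod_cast Nat.card_pos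

lemma eulerRatio_pos (hfin : IsFinitary.{w} C) (M N : C) : 0 < eulerRatio.{w} M N :=
  div_pos (card_hom_pos hfin M N) (card_ext_pos hfin M N)

/-- The positive square root of `|Hom(M, N)| / |Ext¹(M, N)|`, as an element of `ℂˣ`. -/
def positiveRoot (hfin : IsFinitary.{w} C) (M N : C) : ℂˣ :=
  Units.mk0 (Real.sqrt (eulerRatio.{w} M N) : ℂ)
    (by exact_mod_cast (Real.sqrt_pos.mpr (eulerRatio_pos hfin M N)).ne')

lemma positiveRoot_add_right (hfin : IsFinitary.{w} C) (hher : IsHereditary.{w} C)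
    (M : C) (S : ShortComplex C) (hS : S.ShortExact) :
    positiveRoot hfin M S.X₂ = positiveRoot hfin M S.X₁ * positiveRoot hfin M S.X₃ := by
  ext
  simp only [positiveRoot, Units.val_mk0, Units.val_mul]
  rw [← Complex.ofReal_mul, ← Real.sqrt_mul (eulerRatio_pos hfin _ _).le]
  congr 2
  have h : _ = (_ : ℝ) := congrArg Nat.cast (card_covariant.{w} hher M S hS)
  push_cast at h
  have h₁ := (card_ext_pos hfin M S.X₁).ne'
  have h₂ := (card_ext_pos hfin M S.X₂).ne'
  have h₃ := (card_ext_pos hfin M S.X₃).ne'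
  simp only [eulerRatio]
  field_simp
  linear_combination h

lemma positiveRoot_add_left (hfin : IsFinitary.{w} C) (hher : IsHereditary.{w} C)
    (N : C) (S : ShortComplex C) (hS : S.ShortExact) :
    positiveRoot hfin S.X₂ N = positiveRoot hfin S.X₁ N * positiveRoot hfin S.X₃ N := by
  ext
  simp only [positiveRoot, Units.val_mk0, Units.val_mul]
  rw [← Complex.ofReal_mul, ← Real.sqrt_mul (eulerRatio_pos hfin _ _).le]
  congr 2
  have h : _ = (_ : ℝ) := congrArg Nat.cast (card_contravariant.{w} hher N S hS)
  push_cast at h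
  have h₁ := (card_ext_pos hfin S.X₁ N).ne'
  have h₂ := (card_ext_pos hfin S.X₂ N).ne'
  have h₃ := (card_ext_pos hfin S.X₃ N).ne'
  simp only [eulerRatio]
  field_simp
  linear_combination h

/-- The Euler form of a finitary hereditary category defined by the positive square root
`⟨M, N⟩ₘ = (|Hom(M, N)| / |Ext¹(M, N)|)^(1/2) > 0`. -/
def EulerRoot.positive (hfin : IsFinitary.{w} C) (hher : IsHereditary.{w} C) :
    EulerRoot.{w} C where
  form := k0Lift
    (fun M => k0Lift (fun N => Additive.ofMul (positiveRoot hfin M N))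
      (fun S hS => congrArg Additive.ofMul (positiveRoot_add_right hfin hher M S hS)))
    (fun S hS => k0_hom_ext (fun N => by
      simp only [AddMonoidHom.add_apply, k0Lift_k0Class]
      exact congrArg Additive.ofMul (positiveRoot_add_left hfin hher N S hS)))
  form_sq M N := by
    simp only [k0Lift_k0Class, toMul_ofMul, positiveRoot, Units.val_mk0]
    rw [← Complex.ofReal_pow, Real.sq_sqrt (eulerRatio_pos hfin M N).le]
    simp [eulerRatio]

end Positive

namespace EulerRoot

variable [HasExt.{w} C] (χ : EulerRoot.{w} C)

/-- The multiplicative Euler form `⟨α, β⟩ₘ`. -/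
def pair (α β : K0 C) : ℂ := ((χ.form α β).toMul : ℂˣ)

/-- The symmetric multiplicative Euler form `(α, β)ₘ = ⟨α, β⟩ₘ ⟨β, α⟩ₘ`. -/
def symm (α β : K0 C) : ℂ := χ.pair α β * χ.pair β α

end EulerRoot

/-! ### Isomorphism classes and Hall numbers -/

variable (C) in
/-- The set of isomorphism classes of objects of `C`. -/
abbrev IsoClass : Type u := Quotient (isIsomorphicSetoid C)

/-- The isomorphism class of an object. -/
def isoClass (M : C) : IsoClass C := Quotient.mk (isIsomorphicSetoid C) M

namespace IsoClass

/-- A chosen object in an isomorphism class; nothing below depends on the choice. -/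
def rep (M : IsoClass C) : C := Quotient.out M

/-- The class in the Grothendieck group. -/
def k0 (M : IsoClass C) : K0 C := k0Class M.rep

/-- `a_M = |Aut(M)|` -/
def a (M : IsoClass C) : ℕ := Nat.card (Aut M.rep)

end IsoClass

/-- `P^R_{M,N}`: the number of short exact sequences `0 ⟶ N ⟶ R ⟶ M ⟶ 0`, i.e. of pairs of
morphisms `(f, g)` that form such a sequence. -/
def hallP (R M N : IsoClass C) : ℕ :=
  Nat.card { p : (N.rep ⟶ R.rep) × (R.rep ⟶ M.rep) //
    ∃ h : p.1 ≫ p.2 = 0, (ShortComplex.mk p.1 p.2 h).ShortExact }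

/-! ### The extended Hall algebra -/

variable (C) in
/-- The vector space `H̃ = H ⊗ ℂ[K(C)]`, with basis `[M] k_α` indexed by the isomorphism
classes `M` and the elements `α` of `K(C)`. -/
abbrev ExtHall : Type u := IsoClass C × K0 C →₀ ℂ

/-- The basis element `[M] k_α`. -/
def elt (M : IsoClass C) (α : K0 C) : ExtHall C := Finsupp.single (M, α) 1

variable (C) in
/-- The unit element `1 = [0] k_0`. -/
def one : ExtHall C := elt (isoClass (0 : C)) 0

variable (C) in
/-- The unit map `i : ℂ → H̃`, `c ↦ c 1`. -/
def unit : ℂ →ₗ[ℂ] ExtHall C := LinearMap.toSpanSingleton ℂ (ExtHall C) (one C)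

/-- `k_α = [0] k_α` -/
def kElt (α : K0 C) : ExtHall C := elt (isoClass (0 : C)) α

open Classical in
variable (C) in
/-- The counit: `ε([M] k_α) = 1` if `M = 0`, and `0` otherwise. -/
def counit : ExtHall C →ₗ[ℂ] ℂ :=
  Finsupp.linearCombination ℂ fun p : IsoClass C × K0 C =>
    if p.1 = isoClass (0 : C) then (1 : ℂ) else 0

section Structure

variable [HasExt.{w} C] (χ : EulerRoot.{w} C)

/-- The multiplication of `H̃`. It is determined by
`[M] [N] = ⟨M, N⟩ₘ ∑_R P^R_{M,N} / (a_M a_N) [R]`, `k_α k_β = k_{α+β}` and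
`k_α [N] = (α, N)ₘ [N] k_α`, so that
`[M] k_α · [N] k_β = (α, N)ₘ ⟨M, N⟩ₘ ∑_R P^R_{M,N} / (a_M a_N) [R] k_{α+β}`. -/
def mul : ExtHall C →ₗ[ℂ] ExtHall C →ₗ[ℂ] ExtHall C :=
  Finsupp.linearCombination ℂ fun p : IsoClass C × K0 C =>
    Finsupp.linearCombination ℂ fun q : IsoClass C × K0 C =>
      ∑ᶠ R : IsoClass C,
        (χ.symm p.2 q.1.k0 * χ.pair p.1.k0 q.1.k0 *
          ((hallP R p.1 q.1 : ℂ) / ((p.1.a : ℂ) * (q.1.a : ℂ)))) • elt R (p.2 + q.2)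

/-- The multiplication as a map `m : H̃ ⊗ H̃ → H̃`. -/
def mulT : ExtHall C ⊗[ℂ] ExtHall C →ₗ[ℂ] ExtHall C := TensorProduct.lift (mul χ)

/-- The comultiplication of `H̃`:
`Δ([R] k_α) = ∑_{M,N} ⟨M, N⟩ₘ P^R_{M,N} / a_R [M] k_{N+α} ⊗ [N] k_α`. -/
def comul : ExtHall C →ₗ[ℂ] ExtHall C ⊗[ℂ] ExtHall C :=
  Finsupp.linearCombination ℂ fun p : IsoClass C × K0 C =>
    ∑ᶠ MN : IsoClass C × IsoClass C,
      (χ.pair MN.1.k0 MN.2.k0 * ((hallP p.1 MN.1 MN.2 : ℂ) / (p.1.a : ℂ))) •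
        (elt MN.1 (MN.2.k0 + p.2) ⊗ₜ[ℂ] elt MN.2 p.2)

end Structure

/-! ### Strict filtrations and the antipode -/

/-- A strict `r`-step filtration `0 = L_{r+1} ⊊ L_r ⊊ ⋯ ⊊ L_1 = M`, where `L_{i+1}` is `step i`.
For `M ≠ 0` the number `r` of steps is at least `1`; for `M = 0` there is just the empty
filtration, with `r = 0`. -/
structure StrictFiltration (M : C) where
  r : ℕ
  step : Fin (r + 1) → Subobject M
  strictAnti : StrictAnti step
  step_zero : step 0 = ⊤
  step_last : step (Fin.last r) = ⊥

namespace StrictFiltration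

variable {M : C} (F : StrictFiltration M)

/-- The subquotients `L_1 / L_2, …, L_r / L_{r+1}`, in this order. -/
def subquotient (i : Fin F.r) : IsoClass C :=
  isoClass (cokernel (Subobject.ofLE (F.step i.succ) (F.step i.castSucc)
    (F.strictAnti i.castSucc_lt_succ).le))

variable [HasExt.{w} C] (χ : EulerRoot.{w} C)

/-- `(-1)^r ∏ᵢ ⟨L_i / L_{i+1}, L_{i+1}⟩ₘ · (∏ᵢ a_{L_i / L_{i+1}}) / a_M` -/
def coeff : ℂ :=
  (-1) ^ F.r *
    (∏ i : Fin F.r, χ.pair (F.subquotient i).k0 (k0Class (F.step i.succ : C))) *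
    ((∏ i : Fin F.r, ((F.subquotient i).a : ℂ)) / (Nat.card (Aut M) : ℂ))

/-- The product `[L_1 / L_2] · [L_2 / L_3] ⋯ [L_r]` in the Hall algebra. -/
def product : ExtHall C :=
  (List.ofFn fun i : Fin F.r => elt (F.subquotient i) 0).foldr (fun x y => mul χ x y) (one C)

end StrictFiltration

variable [HasExt.{w} C] (χ : EulerRoot.{w} C)

/-- The map `S`: `S([M] k_α) = k_α⁻¹ S([M])`, where `S([M])` is `k_M⁻¹` times the sum over all
strict filtrations of `M` of the corresponding coefficient times the product of subquotients. -/
def antipode : ExtHall C →ₗ[ℂ] ExtHall C :=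
  Finsupp.linearCombination ℂ fun p : IsoClass C × K0 C =>
    mul χ (kElt (-p.2)) (mul χ (kElt (-p.1.k0))
      (∑ᶠ F : StrictFiltration p.1.rep, F.coeff χ • F.product χ))

end HallAlg

end

noncomputable section

set_option linter.unusedSectionVars false

/-! ### Generalities on Hopf algebras -/

/-! The extended Hall algebra is a bialgebra, and `antipode χ` is a two-sided inverse of the
identity for the convolution product on linear endomorphisms. Every such inverse reverses products
and coproducts and respects unit and counit, so all identities for S follow from these two facts.

Associativity and coassociativity both count flags X ≤ Y of subobjects of R (`sum_flags`); the
powers of the Euler form agree because classes in K(C) add along short exact sequences. Finiteness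
of Ext¹ bounds the extensions in a product, finiteness of subobjects bounds coproducts and
filtrations.

Multiplicativity of the coproduct is Green's formula (`green`). Two sequences N → R → M and N' → R →
M' have a unique frame (`existsUnique_frame`): B ⊆ M is the image of N', D ⊆ N is the kernel of N →
M', and with A = M/B, E = N/D there are induced sequences E → M' → A and D → N' → B. Conversely, let
T = M ×_A M' and let P be the pushout of N and N' over D. Completing a frame by a centre R means
giving an extension of T by D with middle term R, together with a morphism P → R compatible with
both extensions (`crossEquiv`). Such morphisms exist exactly when the class in Ext¹(T, D) restricts
along B ⊕ E → T to the class of P, and then they form a torsor under Hom(B ⊕ E, D) (`card_middle`).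
Riedtmann's formula (`finsum_weighted_SES`) turns the sum over R into a count of classes. As Ext² =
0, restriction is surjective and Euler characteristics are multiplicative, and the total is |Ext¹(A,
D)| / |Hom(A, D)|, i.e. ⟨A, D⟩⁻² (`finsum_card_cross`). This is the factor by which the two Euler
twists differ.

Splitting off the first step of a filtration gives a recursion for the sum defining S
(`StrictFiltration.sum_eq`), which says that S is a right convolution inverse of the identity
(`mulT_map_id_antipode_comul`). No second recursion is needed for the other side. The coproduct of
[M] contains k_M ⊗ [M] with k_M invertible, and every other second factor has fewer subobjects, so
the identity is left cancellable (`eq_zero_of_mulT_map_id_comul`); applied to id * (S * id - 1) = 0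
this gives S * id = 1. -/

lemma mul_eq_map₂ {R A : Type*} [CommSemiring R] [Semiring A] [Algebra R A] (x y : A ⊗[R] A) :
    x * y = TensorProduct.map₂ (LinearMap.mul R A) (LinearMap.mul R A) x y := by
  change Algebra.TensorProduct.mul x y = _
  rw [Algebra.TensorProduct.mul]

namespace HopfAlgebra

open WithConv Coalgebra

variable {R A : Type*} [CommSemiring R] [Semiring A] [HopfAlgebra R A]

/-- Uniqueness of inverses in the convolution algebra of maps A → A ⊗ A. With i₁, i₂ the two
inclusions of A, the coproduct is i₁ * i₂, so (i₂ ∘ S) * (i₁ ∘ S) is a left inverse of it; that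
product is the right-hand side, while Δ ∘ S is a right inverse. -/
theorem comul_comp_antipode :
    comul ∘ₗ antipode R (A := A) = TensorProduct.map (antipode R) (antipode R) ∘ₗ
      (TensorProduct.comm R A A).toLinearMap ∘ₗ comul := by
  let i₁ : A →ₐ[R] A ⊗[R] A := Algebra.TensorProduct.includeLeft
  let i₂ : A →ₐ[R] A ⊗[R] A := Algebra.TensorProduct.includeRight
  have h₁ : toConv (i₁.toLinearMap) * toConv (i₂.toLinearMap) = toConv (comul (R := R) (A := A)) := by
    ext a
    rw [(ℛ R a).convMul_apply]
    simp [i₁, i₂, (ℛ R a).eq]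
  have h₂ : toConv (i₂.toLinearMap ∘ₗ antipode R) * toConv (i₁.toLinearMap ∘ₗ antipode R) =
      toConv (TensorProduct.map (antipode R) (antipode R) ∘ₗ
        (TensorProduct.comm R A A).toLinearMap ∘ₗ comul (R := R) (A := A)) := by
    ext a
    rw [(ℛ R a).convMul_apply]
    simp [i₁, i₂, ← (ℛ R a).eq]
  have h (i : A →ₐ[R] A ⊗[R] A) :
      toConv (i.toLinearMap ∘ₗ antipode R) * toConv i.toLinearMap = 1 := by
    ext a
    rw [(ℛ R a).convMul_apply]
    simp [← map_mul, ← map_sum, sum_antipode_mul_eq_algebraMap_counit]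
  apply toConv_injective
  refine (left_inv_eq_right_inv ?_ LinearMap.comul_right_inv).symm
  rw [← h₁, ← h₂, mul_assoc, ← mul_assoc _ (toConv i₁.toLinearMap), h, one_mul, h]

end HopfAlgebra

namespace HallAlg

open Abelian

variable {C : Type u} [Category.{v} C] [Abelian C]

section Triangles

open Pretriangulated DerivedCategory

/-! ### Extension classes and short exact sequences -/

/-- In the long exact homology sequence the neighbours H⁻¹ of the third term and H¹ of the first
vanish, both being concentrated in degree 0. -/
lemma shortExact_of_distTriang [HasDerivedCategory.{w} C] (S : ShortComplex C)
    (h : (singleFunctor C 0).obj S.X₃ ⟶ ((singleFunctor C 0).obj S.X₁)⟦(1 : ℤ)⟧)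
    (hT : Triangle.mk ((singleFunctor C 0).map S.f) ((singleFunctor C 0).map S.g) h ∈
      distTriang (DerivedCategory C)) : S.ShortExact := by
  let F := singleFunctor C 0 ⋙ homologyFunctor C 0
  let e : F ≅ 𝟭 C := singleFunctorCompHomologyFunctorIso C 0
  have : F.PreservesZeroMorphisms := by
    dsimp only [F]; infer_instance
  have hS' : (S.map F).ShortExact := by
    refine { exact := HomologySequence.exact₂ _ hT 0, mono_f := ?_, epi_g := ?_ }
    · refine (HomologySequence.mono_homologyMap_mor₁_iff _ hT (-1) 0).2 ?_
      have := isZero_of_isGE ((singleFunctor C 0).obj S.X₃) 0 (-1) (by lia)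
      exact this.eq_of_src _ _
    · refine (HomologySequence.epi_homologyMap_mor₂_iff _ hT 0 1).2 ?_
      have := isZero_of_isLE ((singleFunctor C 0).obj S.X₁) 0 1 (by lia)
      exact this.eq_of_tgt _ _
  exact ShortComplex.shortExact_of_iso (S.mapNatIso e) hS'

lemma mk_mem_distTriang_of_iso {D : Type*} [Category* D] [HasZeroObject D] [HasShift D ℤ]
    [Preadditive D] [∀ n : ℤ, (shiftFunctor D n).Additive] [Pretriangulated D] {X Y Y' Z : D}
    (e : Y ≅ Y') {f : X ⟶ Y} {g : Y ⟶ Z} {h : Z ⟶ X⟦(1 : ℤ)⟧}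
    (hT : Triangle.mk f g h ∈ distTriang D) {f' : X ⟶ Y'} {g' : Y' ⟶ Z}
    (hf : f' = f ≫ e.hom) (hg : g' = e.inv ≫ g) : Triangle.mk f' g' h ∈ distTriang D := by
  subst hf hg
  refine isomorphic_distinguished _ hT _ (Triangle.isoMk _ _ (Iso.refl X) e.symm (Iso.refl Z)
    ?_ ?_ ?_)
  · change (f ≫ e.hom) ≫ e.inv = 𝟙 X ≫ f
    simp
  · exact Category.comp_id _
  · change h ≫ (shiftFunctor D (1 : ℤ)).map (𝟙 X) = 𝟙 Z ≫ h
    simp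

/-- The identities of X and Y extend to a morphism of triangles. The endomorphism c need not be the
identity in general; where this is applied, g comes from an epimorphism in C, which forces it. -/
lemma exists_comparison_of_distTriang {D : Type*} [Category* D] [HasZeroObject D] [HasShift D ℤ]
    [Preadditive D] [∀ n : ℤ, (shiftFunctor D n).Additive] [Pretriangulated D] {X Y Z : D}
    {f : X ⟶ Y} {g : Y ⟶ Z} {h h' : Z ⟶ X⟦(1 : ℤ)⟧}
    (hT : Triangle.mk f g h ∈ distTriang D) (hT' : Triangle.mk f g h' ∈ distTriang D) :
    ∃ c : Z ⟶ Z, g ≫ c = g ∧ h = c ≫ h' := by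
  obtain ⟨c, hc, hc'⟩ := complete_distinguished_triangle_morphism _ _ hT hT' (𝟙 X) (𝟙 Y)
    ((Category.comp_id _).trans (Category.id_comp _).symm)
  refine ⟨c, hc.trans (Category.id_comp _), Eq.trans ?_ hc'⟩
  change h = h ≫ (shiftFunctor D (1 : ℤ)).map (𝟙 X)
  simp

/-- Complete x, seen as a morphism M → N[1], to a triangle. The heart is closed under extensions, so
the middle term is an object of C in degree 0 and the triangle is a short exact sequence. -/
lemma exists_shortExact_extClass [HasExt.{w} C] {M N : C} (x : Ext.{w} M N 1) :
    ∃ (R : C) (f : N ⟶ R) (g : R ⟶ M) (h : f ≫ g = 0)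
      (hS : (ShortComplex.mk f g h).ShortExact), hS.extClass = x := by
  let := HasDerivedCategory.standard C
  obtain ⟨Y, f, g, mem⟩ := distinguished_cocone_triangle₂ (C := DerivedCategory C)
    (Z := (singleFunctor C 0).obj M) (X := (singleFunctor C 0).obj N) x.hom
  have hGE : Y.IsGE 0 := TStructure.t.isGE₂ _ mem 0
    (inferInstanceAs (((singleFunctor C 0).obj N).IsGE 0))
    (inferInstanceAs (((singleFunctor C 0).obj M).IsGE 0))
  have hLE : Y.IsLE 0 := TStructure.t.isLE₂ _ mem 0
    (inferInstanceAs (((singleFunctor C 0).obj N).IsLE 0))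
    (inferInstanceAs (((singleFunctor C 0).obj M).IsLE 0))
  obtain ⟨R, ⟨e⟩⟩ := exists_iso_singleFunctor_obj_of_isGE_of_isLE Y 0
  let i : N ⟶ R := (singleFunctor C 0).preimage (f ≫ e.hom)
  let p : R ⟶ M := (singleFunctor C 0).preimage (e.inv ≫ g)
  have mem' : Triangle.mk ((singleFunctor C 0).map i) ((singleFunctor C 0).map p) x.hom ∈
      distTriang (DerivedCategory C) := by
    apply mk_mem_distTriang_of_iso e mem <;> simp [i, p]
  have z : i ≫ p = 0 := by
    apply (singleFunctor C 0).map_injective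
    rw [Functor.map_comp, Functor.map_zero]
    exact comp_distTriang_mor_zero₁₂ _ mem'
  have hS : (ShortComplex.mk i p z).ShortExact := shortExact_of_distTriang _ _ mem'
  refine ⟨R, i, p, z, hS, ?_⟩
  ext
  rw [ShortComplex.ShortExact.extClass_hom]
  obtain ⟨c, hc, hc'⟩ := exists_comparison_of_distTriang hS.singleTriangle_distinguished mem'
  obtain ⟨c', rfl⟩ := (singleFunctor C 0).map_surjective c
  have hpc : p ≫ c' = p := by
    apply (singleFunctor C 0).map_injective
    rw [Functor.map_comp]
    exact hc
  have hp : Epi p := hS.epi_g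
  have hc'' : c' = 𝟙 _ := by rw [← cancel_epi p, hpc, Category.comp_id]
  rw [hc', hc'', CategoryTheory.Functor.map_id, Category.id_comp]

/-! ### Morphisms of extensions with prescribed ends -/

section Morphisms

variable [HasExt.{w} C]

/-- A pair of morphisms on the ends of two short exact sequences extends to the middle as soon as
it is compatible with the extension classes. -/
lemma exists_middle_of_extClass {S₁ S₂ : ShortComplex C} (h₁ : S₁.ShortExact) (h₂ : S₂.ShortExact)
    (φ : S₁.X₁ ⟶ S₂.X₁) (γ : S₁.X₃ ⟶ S₂.X₃)
    (h : h₁.extClass.comp (Ext.mk₀.{w} φ) (add_zero 1) =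
      (Ext.mk₀.{w} γ).comp h₂.extClass (zero_add 1)) :
    ∃ u : S₁.X₂ ⟶ S₂.X₂, S₁.f ≫ u = φ ≫ S₂.f ∧ u ≫ S₂.g = S₁.g ≫ γ := by
  have := h₁.mono_f
  have := h₂.mono_f
  have := h₁.epi_g
  -- The obstruction to lifting S₁.g ≫ γ through S₂.g vanishes: by `h` it factors through the
  -- pullback of the class of S₁ along its own projection.
  obtain ⟨u', hu'⟩ := Ext.covariant_sequence_exact₃.{w} S₁.X₂ h₂ (Ext.mk₀ (S₁.g ≫ γ)) (zero_add 1)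
    (by rw [← Ext.mk₀_comp_mk₀, Ext.comp_assoc _ _ _ (zero_add 0) (zero_add 1) (by lia), ← h]
        exact h₁.comp_extClass_assoc _ _)
  obtain ⟨u, rfl⟩ := Ext.mk₀_bijective _ _ |>.2 u'
  rw [Ext.mk₀_comp_mk₀] at hu'
  have hu : u ≫ S₂.g = S₁.g ≫ γ := (Ext.mk₀_bijective _ _).1 hu'
  have z : (S₁.f ≫ u) ≫ S₂.g = 0 := by rw [Category.assoc, hu, S₁.zero_assoc, zero_comp]
  -- The lift u may induce a wrong map θ on the kernels. Since θ - φ kills the class of S₁, it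
  -- extends to η on S₁.X₂, and subtracting η ≫ S₂.f corrects u without changing the map on
  -- quotients.
  let θ : S₁.X₁ ⟶ S₂.X₁ := h₂.exact.lift (S₁.f ≫ u) z
  have hθ : θ ≫ S₂.f = S₁.f ≫ u := h₂.exact.lift_f _ _
  have nat := ShortComplex.ShortExact.extClass_naturality.{w} h₁ h₂
    { τ₁ := θ, τ₂ := u, τ₃ := γ, comm₁₂ := hθ, comm₂₃ := hu }
  dsimp at nat
  have hz : h₁.extClass.comp (Ext.mk₀.{w} (θ - φ)) (add_zero 1) = 0 := by
    rw [sub_eq_add_neg, Ext.mk₀_add, Ext.mk₀_neg, Ext.comp_add, Ext.comp_neg, nat, h,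
      add_neg_cancel]
  obtain ⟨η', hη'⟩ := Ext.contravariant_sequence_exact₁ h₁ S₂.X₁ (Ext.mk₀ (θ - φ)) (add_zero 1) hz
  obtain ⟨η, rfl⟩ := Ext.mk₀_bijective _ _ |>.2 η'
  rw [Ext.mk₀_comp_mk₀] at hη'
  have hη : S₁.f ≫ η = θ - φ := (Ext.mk₀_bijective _ _).1 hη'
  refine ⟨u - η ≫ S₂.f, ?_, ?_⟩
  · rw [Preadditive.comp_sub, ← hθ, reassoc_of% hη, Preadditive.sub_comp]
    abel
  · simp [Preadditive.sub_comp, hu]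

/-- The morphisms over `γ` between the middle terms of two extensions with the same kernel are a
torsor under `Hom`, or there are none. -/
lemma card_middle {D S I R T : C} {i : D ⟶ S} {p : S ⟶ I} {z : i ≫ p = 0}
    (h₁ : (ShortComplex.mk i p z).ShortExact) {d : D ⟶ R} {q : R ⟶ T} {z' : d ≫ q = 0}
    (h₂ : (ShortComplex.mk d q z').ShortExact) (γ : I ⟶ T) [Decidable
      ((Ext.mk₀.{w} γ).comp h₂.extClass (zero_add 1) = h₁.extClass)] :
    Nat.card { u : S ⟶ R // i ≫ u = d ∧ u ≫ q = p ≫ γ } =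
      if (Ext.mk₀.{w} γ).comp h₂.extClass (zero_add 1) = h₁.extClass then
        Nat.card (I ⟶ D) else 0 := by
  split_ifs with h
  · obtain ⟨u₀, hu₀, hu₀'⟩ := exists_middle_of_extClass.{w} h₁ h₂ (𝟙 D) γ (by
      rw [Ext.comp_mk₀_id, h])
    dsimp at hu₀ hu₀'
    rw [Category.id_comp] at hu₀
    have : Mono d := h₂.mono_f
    have : Epi p := h₁.epi_g
    symm
    refine Nat.card_congr (Equiv.ofBijective
      (fun η => ⟨u₀ + p ≫ η ≫ d, by simp [hu₀, reassoc_of% z], by simp [hu₀', z']⟩) ⟨?_, ?_⟩)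
    · intro η η' e
      have e' : u₀ + p ≫ η ≫ d = u₀ + p ≫ η' ≫ d := congrArg Subtype.val e
      have := add_left_cancel e'
      rwa [cancel_epi, cancel_mono] at this
    · rintro ⟨u, hu, hu'⟩
      have e1 : i ≫ (u - u₀) = 0 := by rw [Preadditive.comp_sub, hu, hu₀, sub_self]
      let y : I ⟶ R := h₁.exact.desc (u - u₀) e1
      have hy : p ≫ y = u - u₀ := h₁.exact.g_desc _ _
      have e2 : y ≫ q = 0 := by
        rw [← cancel_epi p, reassoc_of% hy, Preadditive.sub_comp, hu', hu₀', sub_self, comp_zero]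
      refine ⟨h₂.exact.lift y e2, Subtype.ext ?_⟩
      have : h₂.exact.lift y e2 ≫ d = y := h₂.exact.lift_f _ _
      dsimp only
      rw [this, hy]
      abel
  · rw [Nat.card_eq_zero]
    left
    refine ⟨fun ⟨u, hu, hu'⟩ => h ?_⟩
    have := ShortComplex.ShortExact.extClass_naturality.{w} h₁ h₂
      { τ₁ := 𝟙 D, τ₂ := u, τ₃ := γ, comm₁₂ := by simpa using hu.symm, comm₂₃ := hu' }
    dsimp at this
    rw [← this, Ext.comp_mk₀_id]

end Morphisms

end Triangles

/-! ### The set of short exact sequences with given terms -/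

/-- The short exact sequences `0 ⟶ N ⟶ R ⟶ M ⟶ 0`. -/
abbrev SES (M N R : C) : Type v :=
  { p : (N ⟶ R) × (R ⟶ M) // ∃ h : p.1 ≫ p.2 = 0, (ShortComplex.mk p.1 p.2 h).ShortExact }

namespace SES

variable {M N R : C}

/-- The sequence given by an element of `SES M N R`. -/
abbrev complex (p : SES M N R) : ShortComplex C := ShortComplex.mk p.1.1 p.1.2 p.2.choose

lemma shortExact (p : SES M N R) : p.complex.ShortExact := p.2.choose_spec

lemma mono (p : SES M N R) : Mono p.1.1 := p.shortExact.mono_f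

lemma epi (p : SES M N R) : Epi p.1.2 := p.shortExact.epi_g

lemma zero (p : SES M N R) : p.1.1 ≫ p.1.2 = 0 := p.2.choose

/-- Lift a morphism killed by the projection. -/
def lift (p : SES M N R) {W : C} (x : W ⟶ R) (h : x ≫ p.1.2 = 0) : W ⟶ N :=
  have := p.shortExact.mono_f
  p.shortExact.exact.lift x h

@[simp]
lemma lift_comp (p : SES M N R) {W : C} (x : W ⟶ R) (h : x ≫ p.1.2 = 0) :
    p.lift x h ≫ p.1.1 = x :=
  have := p.shortExact.mono_f
  p.shortExact.exact.lift_f x h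

@[simp]
lemma lift_comp_assoc (p : SES M N R) {W Z : C} (x : W ⟶ R) (h : x ≫ p.1.2 = 0) (z : R ⟶ Z) :
    p.lift x h ≫ p.1.1 ≫ z = x ≫ z := by
  rw [← Category.assoc, lift_comp]

/-- Descend a morphism that kills the inclusion. -/
def desc (p : SES M N R) {W : C} (x : R ⟶ W) (h : p.1.1 ≫ x = 0) : M ⟶ W :=
  have := p.shortExact.epi_g
  p.shortExact.exact.desc x h

@[simp]
lemma comp_desc (p : SES M N R) {W : C} (x : R ⟶ W) (h : p.1.1 ≫ x = 0) :
    p.1.2 ≫ p.desc x h = x :=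
  have := p.shortExact.epi_g
  p.shortExact.exact.g_desc x h

@[simp]
lemma comp_desc_assoc (p : SES M N R) {W Z : C} (x : R ⟶ W) (h : p.1.1 ≫ x = 0) (z : W ⟶ Z) :
    p.1.2 ≫ p.desc x h ≫ z = x ≫ z := by
  rw [← Category.assoc, comp_desc]

lemma hom_ext_left (p : SES M N R) {W : C} {x y : W ⟶ N} (h : x ≫ p.1.1 = y ≫ p.1.1) : x = y :=
  have := p.mono
  (cancel_mono p.1.1).1 h

lemma hom_ext_right (p : SES M N R) {W : C} {x y : M ⟶ W} (h : p.1.2 ≫ x = p.1.2 ≫ y) : x = y :=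
  have := p.epi
  (cancel_epi p.1.2).1 h

lemma exists_refinement (p : SES M N R) {W : C} (x : W ⟶ M) :
    ∃ (W' : C) (π : W' ⟶ W) (_ : Epi π) (y : W' ⟶ R), π ≫ x = y ≫ p.1.2 :=
  (epi_iff_surjective_up_to_refinements p.1.2).1 p.epi x

/-- Construct a short exact sequence by chasing generalized elements. -/
def ofRefinements (f : N ⟶ R) (g : R ⟶ M) (z : f ≫ g = 0)
    (hf : ∀ ⦃W : C⦄ (x : W ⟶ N), x ≫ f = 0 → x = 0)
    (hg : ∀ ⦃W : C⦄ (x : W ⟶ M), ∃ (W' : C) (π : W' ⟶ W) (_ : Epi π) (y : W' ⟶ R),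
      π ≫ x = y ≫ g)
    (hfg : ∀ ⦃W : C⦄ (x : W ⟶ R), x ≫ g = 0 →
      ∃ (W' : C) (π : W' ⟶ W) (_ : Epi π) (y : W' ⟶ N), π ≫ x = y ≫ f) : SES M N R :=
  ⟨(f, g), z,
    { exact := (ShortComplex.exact_iff_exact_up_to_refinements _).2 hfg
      mono_f := Preadditive.mono_of_cancel_zero f (fun x hx => hf x hx)
      epi_g := (epi_iff_surjective_up_to_refinements g).2 hg }⟩

/-- Transport along isomorphisms of the three terms. -/
def congr {M' N' R' : C} (eM : M ≅ M') (eN : N ≅ N') (eR : R ≅ R') : SES M N R ≃ SES M' N' R' where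
  toFun p := ⟨(eN.inv ≫ p.1.1 ≫ eR.hom, eR.inv ≫ p.1.2 ≫ eM.hom), by simp [reassoc_of% p.zero],
    ShortComplex.shortExact_of_iso (ShortComplex.isoMk eN eR eM (by simp) (by simp)) p.shortExact⟩
  invFun p := ⟨(eN.hom ≫ p.1.1 ≫ eR.inv, eR.hom ≫ p.1.2 ≫ eM.inv), by simp [reassoc_of% p.zero],
    ShortComplex.shortExact_of_iso (ShortComplex.isoMk eN.symm eR.symm eM.symm (by simp) (by simp))
      p.shortExact⟩
  left_inv p := by ext <;> simp
  right_inv p := by ext <;> simp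

lemma k0Class_eq (p : SES M N R) : k0Class R = k0Class N + k0Class M := by
  unfold k0Class
  rw [← QuotientAddGroup.mk_add, QuotientAddGroup.eq, ← neg_mem_iff]
  apply AddSubgroup.subset_closure
  refine ⟨p.complex, p.shortExact, ?_⟩
  simp only [neg_add_rev, neg_neg, sub_eq_add_neg]
  abel

lemma isIso_of_middle {R' : C} (p : SES M N R) (p' : SES M N R') (u : R ⟶ R')
    (h : p.1.1 ≫ u = p'.1.1) (h' : u ≫ p'.1.2 = p.1.2) : IsIso u := by
  let φ : p.complex ⟶ p'.complex :=
    { τ₁ := 𝟙 N, τ₂ := u, τ₃ := 𝟙 M, comm₁₂ := by simpa using h.symm, comm₂₃ := by simpa using h' }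
  exact ShortComplex.isIso₂_of_shortExact_of_isIso₁₃ φ p.shortExact p'.shortExact

variable [HasExt.{w} C]

/-- The class of a short exact sequence in `Ext¹`. -/
def cls (p : SES M N R) : Ext.{w} M N 1 := p.shortExact.extClass

lemma exists_cls_eq (x : Ext.{w} M N 1) : ∃ (R : C) (p : SES M N R), p.cls = x := by
  obtain ⟨R, f, g, h, hS, hx⟩ := exists_shortExact_extClass x
  exact ⟨R, ⟨(f, g), h, hS⟩, hx⟩

/-- Equal classes let the identities on both ends extend to the middle, where the result is
invertible by the five lemma. -/
lemma nonempty_iso_of_cls_eq {R' : C} (p : SES M N R) (p' : SES M N R')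
    (h : p.cls.{w} = p'.cls) : Nonempty (R ≅ R') := by
  obtain ⟨u, hu, hu'⟩ := exists_middle_of_extClass.{w} p.shortExact p'.shortExact (𝟙 N) (𝟙 M) (by
    rw [Ext.comp_mk₀_id, Ext.mk₀_id_comp]; exact h)
  have := isIso_of_middle p p' u (by simpa using hu) (by simpa using hu')
  exact ⟨asIso u⟩

lemma cls_congr_middle {R' : C} (e : R ≅ R') (p : SES M N R) :
    (congr (Iso.refl M) (Iso.refl N) e p).cls.{w} = p.cls := by
  have := ShortComplex.ShortExact.extClass_naturality.{w} p.shortExact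
    (congr (Iso.refl M) (Iso.refl N) e p).shortExact
    { τ₁ := 𝟙 N, τ₂ := e.hom, τ₃ := 𝟙 M
      comm₁₂ := by simp [congr], comm₂₃ := by simp [congr] }
  dsimp at this
  rw [Ext.comp_mk₀_id, Ext.mk₀_id_comp] at this
  exact this.symm

instance [∀ M N : C, Finite (M ⟶ N)] : Finite (R ≅ R) :=
  Finite.of_injective (fun e => e.hom) (fun _ _ h => Iso.ext h)

instance [∀ M N : C, Finite (M ⟶ N)] : Finite (Aut R) :=
  inferInstanceAs (Finite (R ≅ R))

/-- Orbit counting for Aut(R) acting on sequences: the orbit of p consists of the sequences with the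
same class, and each fibre of g ↦ g · p is a torsor under Hom(M, N) by `card_middle`. -/
lemma card_aut [∀ M N : C, Finite (M ⟶ N)] (p : SES M N R) :
    Nat.card (Aut R) = Nat.card { q : SES M N R // q.cls.{w} = p.cls } * Nat.card (M ⟶ N) := by
  classical
  let F (g : R ≅ R) : { q : SES M N R // q.cls.{w} = p.cls } :=
    ⟨congr (Iso.refl M) (Iso.refl N) g p, cls_congr_middle g p⟩
  have key (q : { q : SES M N R // q.cls.{w} = p.cls }) :
      Nat.card { g : R ≅ R // F g = q } = Nat.card (M ⟶ N) := by
    have := card_middle.{w} p.shortExact q.1.shortExact (𝟙 M)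
    rw [if_pos (by rw [Ext.mk₀_id_comp]; exact q.2)] at this
    rw [← this]
    refine Nat.card_congr (Equiv.ofBijective (fun g => ⟨g.1.hom, ?_, ?_⟩) ⟨?_, ?_⟩)
    · obtain ⟨g, rfl⟩ := g
      simp [F, congr]
    · obtain ⟨g, rfl⟩ := g
      simp [F, congr]
    · intro g g' h
      exact Subtype.ext (Iso.ext (congrArg Subtype.val h))
    · rintro ⟨u, hu, hu'⟩
      rw [Category.comp_id] at hu'
      have := isIso_of_middle p q.1 u hu hu'
      refine ⟨⟨asIso u, Subtype.ext (Subtype.ext (Prod.ext ?_ ?_))⟩, rfl⟩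
      · simpa [F, congr] using hu
      · simpa [F, congr] using hu'.symm
  have : Fintype { q : SES M N R // q.cls.{w} = p.cls } := Fintype.ofFinite _
  change Nat.card (R ≅ R) = _
  rw [← Nat.card_congr (Equiv.sigmaFiberEquiv F), Nat.card_sigma]
  simp only [key, Finset.sum_const, smul_eq_mul, Finset.card_univ, Nat.card_eq_fintype_card]

end SES

lemma isoClass_eq_iff {M N : C} : isoClass M = isoClass N ↔ Nonempty (M ≅ N) :=
  Quotient.eq (r := isIsomorphicSetoid C)

lemma isoClass_rep (R : IsoClass C) : isoClass R.rep = R := Quotient.out_eq _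

lemma nonempty_rep_iso (M : C) : Nonempty ((isoClass M).rep ≅ M) :=
  isoClass_eq_iff.1 (isoClass_rep _)

/-! ### Riedtmann's formula: counting extensions by their middle term -/

section Riedtmann

variable [∀ M N : C, Finite (M ⟶ N)]

lemma a_ne_zero (R : IsoClass C) : (R.a : ℂ) ≠ 0 := by
  unfold IsoClass.a
  exact_mod_cast Nat.card_pos.ne'

lemma card_hom_ne_zero (M N : C) : (Nat.card (M ⟶ N) : ℂ) ≠ 0 := by
  exact_mod_cast Nat.card_pos.ne'

variable [HasExt.{w} C] [∀ M N : C, Finite (Ext.{w} M N 1)]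

/-- The class of an extension determines its middle term, so these R inject into the finite group
Ext¹(M, N). -/
lemma finite_setOf_nonempty_SES (M N : C) : {R : IsoClass C | Nonempty (SES M N R.rep)}.Finite := by
  let F (R : {R : IsoClass C | Nonempty (SES M N R.rep)}) : Ext.{w} M N 1 := R.2.some.cls
  have : Function.Injective F := fun R R' h => by
    apply Subtype.ext
    rw [← isoClass_rep R.1, ← isoClass_rep R'.1, isoClass_eq_iff]
    exact SES.nonempty_iso_of_cls_eq _ _ h
  exact Set.finite_coe_iff.1 (Finite.of_injective F this)

lemma card_ext_ne_zero (M N : C) : (Nat.card (Ext.{w} M N 1) : ℂ) ≠ 0 := by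
  exact_mod_cast Nat.card_pos.ne'

/-- Only one isomorphism class R realizes ξ, and its term is given by `SES.card_aut`. -/
lemma finsum_card_cls (M N : C) (ξ : Ext.{w} M N 1) :
    ∑ᶠ R : IsoClass C, (Nat.card { q : SES M N R.rep // q.cls = ξ } : ℂ) / R.a =
      1 / Nat.card (M ⟶ N) := by
  obtain ⟨R, p, rfl⟩ := SES.exists_cls_eq ξ
  obtain ⟨e⟩ := nonempty_rep_iso R
  let p' : SES M N (isoClass R).rep := SES.congr (Iso.refl M) (Iso.refl N) e.symm p
  have hp' : p'.cls.{w} = p.cls := SES.cls_congr_middle _ _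
  rw [finsum_eq_single _ (isoClass R)]
  · have := SES.card_aut.{w} p'
    rw [← hp']
    have h1 : ((isoClass R).a : ℂ) = _ := congrArg Nat.cast this
    push_cast at h1
    have h2 := a_ne_zero (isoClass R)
    have h3 := card_hom_ne_zero M N
    rw [div_eq_div_iff h2 h3, h1]
    ring
  · intro R' hR'
    have : IsEmpty { q : SES M N R'.rep // q.cls.{w} = p.cls } := by
      refine ⟨fun q => hR' ?_⟩
      rw [← isoClass_rep R', isoClass_eq_iff]
      exact SES.nonempty_iso_of_cls_eq _ _ q.2
    rw [Nat.card_of_isEmpty]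
    simp

/-- Riedtmann's formula, in weighted form. -/
lemma finsum_weighted_SES (M N : C) (φ : Ext.{w} M N 1 → ℂ) [Fintype (Ext.{w} M N 1)]
    [∀ R : C, Fintype (SES M N R)] :
    ∑ᶠ R : IsoClass C, (∑ p : SES M N R.rep, φ p.cls) / (R.a : ℂ) =
      (∑ ξ, φ ξ) / Nat.card (M ⟶ N) := by
  classical
  have h (R : IsoClass C) : (∑ p : SES M N R.rep, φ p.cls) / (R.a : ℂ) =
      ∑ ξ, φ ξ * ((Nat.card { q : SES M N R.rep // q.cls = ξ } : ℂ) / R.a) := by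
    rw [← Finset.sum_fiberwise Finset.univ SES.cls, Finset.sum_div]
    refine Finset.sum_congr rfl fun ξ _ => ?_
    rw [Finset.sum_congr rfl (g := fun _ => φ ξ) (by simp +contextual), Finset.sum_const,
      nsmul_eq_mul, Nat.card_eq_fintype_card, Fintype.card_subtype]
    ring
  simp_rw [h]
  rw [finsum_sum_comm]
  · rw [Finset.sum_div]
    refine Finset.sum_congr rfl fun ξ _ => ?_
    rw [← mul_finsum, finsum_card_cls]
    ring
  · intro ξ _
    refine (finite_setOf_nonempty_SES M N).subset fun R hR => ?_
    by_contra hne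
    have : IsEmpty (SES M N R.rep) := not_nonempty_iff.1 hne
    apply hR
    dsimp only
    rw [Nat.card_of_isEmpty]
    simp

end Riedtmann

/-! ### Completing a frame of short exact sequences to a `3 × 3` diagram -/

section Frame

attribute [local simp] pushout.inl_desc pushout.inl_desc_assoc pushout.inr_desc
  pushout.inr_desc_assoc pullback.lift_fst pullback.lift_fst_assoc pullback.lift_snd
  pullback.lift_snd_assoc

variable {A B E D M N M' N' R S T : C}
  (pM : SES A B M) (pN : SES E D N) (pM' : SES A E M') (pN' : SES B D N')

/-- The conditions on two short exact sequences through `R` to form the middle row and the middle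
column of a `3 × 3` diagram whose outer rows and columns are given. -/
def IsCross (x : SES M N R × SES M' N' R) : Prop :=
  x.1.1.1 ≫ x.2.1.2 = pN.1.2 ≫ pM'.1.1 ∧ x.2.1.1 ≫ x.1.1.2 = pN'.1.2 ≫ pM.1.1 ∧
    pN.1.1 ≫ x.1.1.1 = pN'.1.1 ≫ x.2.1.1 ∧ x.1.1.2 ≫ pM.1.2 = x.2.1.2 ≫ pM'.1.2

/-! ### A sequence through R versus the sequence from D through R to the fibre product -/

section Diagonal

variable {fst : T ⟶ M} {snd : T ⟶ M'} (hT : IsPullback fst snd pM.1.2 pM'.1.2)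
  {a : N ⟶ R} {b : R ⟶ M} {b' : R ⟶ M'} {q : R ⟶ T}
  (hfst : q ≫ fst = b) (hsnd : q ≫ snd = b') (hab' : a ≫ b' = pN.1.2 ≫ pM'.1.1)

include hT hfst hsnd hab'

/-- The kernel of R → M ×_A M' is the part of N mapping to 0 in M', which is D, since N → M' factors
as the epimorphism N → E followed by a monomorphism. -/
lemma isSES_diagonal (hab : ∃ h : a ≫ b = 0, (ShortComplex.mk a b h).ShortExact) :
    ∃ h : (pN.1.1 ≫ a) ≫ q = 0, (ShortComplex.mk (pN.1.1 ≫ a) q h).ShortExact := by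
  obtain ⟨p, rfl, rfl⟩ : ∃ p : SES M N R, p.1.1 = a ∧ p.1.2 = b := ⟨⟨(a, b), hab⟩, rfl, rfl⟩
  have hsq : p.1.2 ≫ pM.1.2 = b' ≫ pM'.1.2 := by
    rw [← hfst, ← hsnd, Category.assoc, Category.assoc, hT.w]
  refine (SES.ofRefinements (pN.1.1 ≫ p.1.1) q ?_ ?_ ?_ ?_).2
  · apply hT.hom_ext
    · rw [Category.assoc, Category.assoc, hfst, p.zero, comp_zero, zero_comp]
    · rw [Category.assoc, Category.assoc, hsnd, hab', reassoc_of% pN.zero, zero_comp, zero_comp]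
  · intro W x hx
    exact pN.hom_ext_left (p.hom_ext_left (by simpa using hx))
  · intro W x
    obtain ⟨W₁, π, _, r, hr⟩ := p.exists_refinement (x ≫ fst)
    -- A lift r of the M-component misses the M'-component by an element of E, which is then removed
    -- by an element of N.
    have hy : (r ≫ b' - π ≫ x ≫ snd) ≫ pM'.1.2 = 0 := by
      rw [Preadditive.sub_comp, Category.assoc, Category.assoc, Category.assoc, ← hsq, ← hT.w,
        ← reassoc_of% hr, sub_self]
    obtain ⟨W₂, π₂, _, n, hn⟩ := pN.exists_refinement (pM'.lift _ hy)
    refine ⟨W₂, π₂ ≫ π, epi_comp _ _, π₂ ≫ r - n ≫ p.1.1, hT.hom_ext ?_ ?_⟩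
    · simp [hfst, ← hr, p.zero]
    · simp [hsnd, hab', ← reassoc_of% hn]
  · intro W x hx
    have h1 : x ≫ p.1.2 = 0 := by rw [← hfst, reassoc_of% hx, zero_comp]
    have h2 : x ≫ b' = 0 := by rw [← hsnd, reassoc_of% hx, zero_comp]
    have h3 : p.lift x h1 ≫ pN.1.2 = 0 := by
      apply pM'.hom_ext_left
      rw [Category.assoc, ← hab', p.lift_comp_assoc, h2, zero_comp]
    exact ⟨W, 𝟙 W, inferInstance, pN.lift _ h3, by simp⟩

lemma isSES_of_diagonal (z : a ≫ b = 0)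
    (h : ∃ h : (pN.1.1 ≫ a) ≫ q = 0, (ShortComplex.mk (pN.1.1 ≫ a) q h).ShortExact) :
    ∃ h : a ≫ b = 0, (ShortComplex.mk a b h).ShortExact := by
  obtain ⟨r, hr₁, rfl⟩ : ∃ r : SES T D R, r.1.1 = pN.1.1 ≫ a ∧ r.1.2 = q :=
    ⟨⟨(_, q), h⟩, rfl, rfl⟩
  have hsq : b ≫ pM.1.2 = b' ≫ pM'.1.2 := by
    rw [← hfst, ← hsnd, Category.assoc, Category.assoc, hT.w]
  refine (SES.ofRefinements a b z ?_ ?_ ?_).2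
  · intro W x hx
    have h1 : x ≫ pN.1.2 = 0 := by
      apply pM'.hom_ext_left
      rw [Category.assoc, ← hab', reassoc_of% hx, zero_comp, zero_comp]
    have h2 : pN.lift x h1 = 0 := by
      apply r.hom_ext_left
      rw [hr₁, pN.lift_comp_assoc, hx, zero_comp]
    rw [← pN.lift_comp x h1, h2, zero_comp]
  · intro W x
    obtain ⟨W₁, π, _, m, hm⟩ := pM'.exists_refinement (x ≫ pM.1.2)
    obtain ⟨W₂, π₂, _, y, hy⟩ := r.exists_refinement
      (hT.lift (π ≫ x) m (by rw [Category.assoc, hm]))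
    refine ⟨W₂, π₂ ≫ π, epi_comp _ _, y, ?_⟩
    rw [← hfst, ← reassoc_of% hy, hT.lift_fst, Category.assoc]
  · intro W x hx
    have h1 : (x ≫ b') ≫ pM'.1.2 = 0 := by rw [Category.assoc, ← hsq, reassoc_of% hx, zero_comp]
    obtain ⟨W₁, π, _, n, hn⟩ := pN.exists_refinement (pM'.lift _ h1)
    have h2 : (π ≫ x - n ≫ a) ≫ r.1.2 = 0 := by
      apply hT.hom_ext
      · simp [hfst, hx, z]
      · simp [hsnd, hab', ← reassoc_of% hn]
    refine ⟨W₁, π, inferInstance, r.lift _ h2 ≫ pN.1.1 + n, ?_⟩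
    rw [Preadditive.add_comp, Category.assoc, ← hr₁, r.lift_comp, sub_add_cancel]

end Diagonal

/-- The amalgamated sum of `N` and `N'` over `D` as an extension of `B ⊞ E`. -/
def cornerSES : SES (B ⊞ E) D (pushout pN.1.1 pN'.1.1) :=
  SES.ofRefinements (pN.1.1 ≫ pushout.inl _ _)
    (pushout.desc (pN.1.2 ≫ biprod.inr) (pN'.1.2 ≫ biprod.inl)
      (by rw [reassoc_of% pN.zero, reassoc_of% pN'.zero, zero_comp, zero_comp]))
    (by simp [reassoc_of% pN.zero])
    (by
      intro W x hx
      have := pN.mono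
      have := pN'.mono
      have : Mono (pN.1.1 ≫ pushout.inl pN.1.1 pN'.1.1) := mono_comp _ _
      exact zero_of_comp_mono _ hx)
    (by
      intro W x
      obtain ⟨W₁, π₁, _, y, hy⟩ := pN'.exists_refinement (x ≫ biprod.fst)
      obtain ⟨W₂, π₂, _, z, hz⟩ := pN.exists_refinement (π₁ ≫ x ≫ biprod.snd)
      refine ⟨W₂, π₂ ≫ π₁, epi_comp _ _, π₂ ≫ y ≫ pushout.inr _ _ + z ≫ pushout.inl _ _, ?_⟩
      apply biprod.hom_ext
      · simp [hy]
      · simp [hz])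
    (by
      intro W x hx
      -- After refinement a generalized element of the pushout is a sum of elements n of N and n' of
      -- N'; if it vanishes in B ⊞ E, both already come from D.
      have hepi : Epi (biprod.desc (pushout.inl pN.1.1 pN'.1.1) (pushout.inr pN.1.1 pN'.1.1)) :=
        Preadditive.epi_of_cancel_zero _ (fun g hg => pushout.hom_ext
          (by simpa using biprod.inl ≫= hg) (by simpa using biprod.inr ≫= hg))
      obtain ⟨W₁, π₁, _, y, hy⟩ := (epi_iff_surjective_up_to_refinements _).1 hepi x
      have hy' : y = (y ≫ biprod.fst) ≫ biprod.inl + (y ≫ biprod.snd) ≫ biprod.inr := by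
        rw [Category.assoc, Category.assoc, ← Preadditive.comp_add, biprod.total, Category.comp_id]
      generalize y ≫ biprod.fst = n at hy'
      generalize y ≫ biprod.snd = n' at hy'
      subst hy'
      simp only [Preadditive.add_comp, Category.assoc, biprod.inl_desc, biprod.inr_desc] at hy
      have h0 := π₁ ≫= hx
      rw [reassoc_of% hy] at h0
      have h1 : n ≫ pN.1.2 = 0 := by simpa using h0 =≫ biprod.snd
      have h2 : n' ≫ pN'.1.2 = 0 := by simpa using h0 =≫ biprod.fst
      refine ⟨W₁, π₁, inferInstance, pN.lift n h1 + pN'.lift n' h2, ?_⟩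
      rw [hy, Preadditive.add_comp, pN.lift_comp_assoc, pushout.condition, pN'.lift_comp_assoc])

/-- The fibre product of `M` and `M'` over `A` as an extension by `B ⊞ E`. -/
def rimSES : SES A (B ⊞ E) (pullback pM.1.2 pM'.1.2) :=
  SES.ofRefinements
    (biprod.desc (pullback.lift pM.1.1 0 (by rw [pM.zero, zero_comp]))
      (pullback.lift 0 pM'.1.1 (by rw [pM'.zero, zero_comp])))
    (pullback.fst _ _ ≫ pM.1.2)
    (by apply biprod.hom_ext' <;> simp [pM.zero])
    (by
      intro W x hx
      have h1 := hx =≫ pullback.fst _ _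
      have h2 := hx =≫ pullback.snd _ _
      apply biprod.hom_ext
      · apply pM.hom_ext_left
        rw [biprod.desc_eq] at h1
        simpa using h1
      · apply pM'.hom_ext_left
        rw [biprod.desc_eq] at h2
        simpa using h2)
    (by
      intro W x
      have := pM.epi
      have := pM'.epi
      exact (epi_iff_surjective_up_to_refinements _).1
        (inferInstanceAs (Epi (pullback.fst pM.1.2 pM'.1.2 ≫ pM.1.2))) x)
    (by
      intro W x hx
      have h1 : (x ≫ pullback.fst _ _) ≫ pM.1.2 = 0 := by simpa using hx
      have h2 : (x ≫ pullback.snd _ _) ≫ pM'.1.2 = 0 := by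
        rw [Category.assoc, ← pullback.condition]; exact hx
      refine ⟨W, 𝟙 W, inferInstance, biprod.lift (pM.lift _ h1) (pM'.lift _ h2), ?_⟩
      rw [biprod.lift_desc, Category.id_comp]
      apply pullback.hom_ext <;> simp)

/-- The composite from the pushout through R to the fibre product depends only on the frame: it
factors through B ⊞ E. -/
lemma cross_w {x : SES M N R × SES M' N' R} (hx : IsCross pM pN pM' pN' x) :
    pushout.desc x.1.1.1 x.2.1.1 hx.2.2.1 ≫ pullback.lift x.1.1.2 x.2.1.2 hx.2.2.2 =
      (cornerSES pN pN').1.2 ≫ (rimSES pM pM').1.1 := by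
  apply pushout.hom_ext <;> apply pullback.hom_ext <;>
    simp [cornerSES, rimSES, SES.ofRefinements, SES.zero, hx.1, hx.2.1]

section

variable {pM pN pM' pN'} (y : Σ r : SES (pullback pM.1.2 pM'.1.2) D R, { u : pushout pN.1.1 pN'.1.1 ⟶ R //
  (cornerSES pN pN').1.1 ≫ u = r.1.1 ∧
    u ≫ r.1.2 = (cornerSES pN pN').1.2 ≫ (rimSES pM pM').1.1 })

lemma inl_comp_middle :
    (pushout.inl _ _ ≫ y.2.1) ≫ y.1.1.2 ≫ pullback.snd _ _ = pN.1.2 ≫ pM'.1.1 := by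
  rw [Category.assoc, reassoc_of% y.2.2.2]
  simp [cornerSES, rimSES, SES.ofRefinements]

lemma inr_comp_middle :
    (pushout.inr _ _ ≫ y.2.1) ≫ y.1.1.2 ≫ pullback.fst _ _ = pN'.1.2 ≫ pM.1.1 := by
  rw [Category.assoc, reassoc_of% y.2.2.2]
  simp [cornerSES, rimSES, SES.ofRefinements]

lemma diag_inl : pN.1.1 ≫ pushout.inl _ _ ≫ y.2.1 = y.1.1.1 := by
  refine Eq.trans ?_ y.2.2.1
  simp [cornerSES, SES.ofRefinements]

lemma diag_inr : pN'.1.1 ≫ pushout.inr _ _ ≫ y.2.1 = y.1.1.1 := by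
  rw [← pushout.condition_assoc, diag_inl]

end

/-- The completions of a frame to a `3 × 3` diagram with centre `R` are the extensions of the fibre
product by `D` together with a morphism from the amalgamated sum. -/
def crossEquiv : { x : SES M N R × SES M' N' R // IsCross pM pN pM' pN' x } ≃
    Σ r : SES (pullback pM.1.2 pM'.1.2) D R, { u : pushout pN.1.1 pN'.1.1 ⟶ R //
      (cornerSES pN pN').1.1 ≫ u = r.1.1 ∧
        u ≫ r.1.2 = (cornerSES pN pN').1.2 ≫ (rimSES pM pM').1.1 } where
  toFun x := ⟨⟨(pN.1.1 ≫ x.1.1.1.1, pullback.lift x.1.1.1.2 x.1.2.1.2 x.2.2.2.2),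
      isSES_diagonal pM pN pM' (IsPullback.of_hasPullback _ _) (pullback.lift_fst _ _ _)
        (pullback.lift_snd _ _ _) x.2.1 x.1.1.2⟩,
    ⟨pushout.desc x.1.1.1.1 x.1.2.1.1 x.2.2.2.1, by simp [cornerSES, SES.ofRefinements],
      cross_w pM pN pM' pN' x.2⟩⟩
  invFun y := ⟨(⟨(pushout.inl _ _ ≫ y.2.1, y.1.1.2 ≫ pullback.fst _ _),
      isSES_of_diagonal pM pN pM' (IsPullback.of_hasPullback _ _) rfl rfl (inl_comp_middle y) (by
          rw [Category.assoc, reassoc_of% y.2.2.2]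
          simp [cornerSES, rimSES, SES.ofRefinements])
        (by rw [diag_inl y]; exact y.1.2)⟩,
    ⟨(pushout.inr _ _ ≫ y.2.1, y.1.1.2 ≫ pullback.snd _ _),
      isSES_of_diagonal pM' pN' pM (IsPullback.of_hasPullback _ _).flip rfl rfl (inr_comp_middle y)
        (by
          rw [Category.assoc, reassoc_of% y.2.2.2]
          simp [cornerSES, rimSES, SES.ofRefinements])
        (by rw [diag_inr y]; exact y.1.2)⟩), inl_comp_middle y, inr_comp_middle y,
    (diag_inl y).trans (diag_inr y).symm, by simp [pullback.condition]⟩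
  left_inv x := by
    apply Subtype.ext
    ext <;> simp
  right_inv y := by
    obtain ⟨⟨⟨d, q⟩, hr⟩, u, hu, hu'⟩ := y
    dsimp only at hu hu'
    subst hu
    have h1 : pushout.desc (pushout.inl _ _ ≫ u) (pushout.inr pN.1.1 pN'.1.1 ≫ u)
        (by rw [pushout.condition_assoc]) = u := by apply pushout.hom_ext <;> simp
    have h2 : pullback.lift (q ≫ pullback.fst _ _) (q ≫ pullback.snd pM.1.2 pM'.1.2)
        (by rw [Category.assoc, Category.assoc, pullback.condition]) = q := by
      apply pullback.hom_ext <;> simp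
    refine Sigma.subtype_ext (Subtype.ext (Prod.ext ?_ h2)) h1
    simp [cornerSES, SES.ofRefinements]

end Frame

/-! ### Green's formula -/

section FrameCount

variable [HasExt.{w} C]

/-- Restriction Ext¹(T, D) → Ext¹(I, D) is surjective because Ext²(A, D) = 0, so every fibre is a
coset of its kernel. -/
lemma card_extensions_restricting (hher : IsHereditary.{w} C)
    [∀ M N : C, Finite (Ext.{w} M N 1)] {A I T : C} (p : SES A I T) (D : C)
    (σ : Ext.{w} I D 1) :
    Nat.card { ξ : Ext.{w} T D 1 // (Ext.mk₀ p.1.1).comp ξ (zero_add 1) = σ } *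
      Nat.card (Ext.{w} I D 1) = Nat.card (Ext.{w} T D 1) := by
  let f : Ext.{w} T D 1 →+ Ext.{w} I D 1 :=
    AddMonoidHom.mk' (fun ξ => (Ext.mk₀ p.1.1).comp ξ (zero_add 1)) (fun _ _ => Ext.comp_add _ _ _ _)
  have hf : Function.Surjective f := fun x => by
    have := hher A D 2 le_rfl
    exact Ext.contravariant_sequence_exact₁ p.shortExact D x rfl (Subsingleton.elim _ _)
  rw [card_eq_ker_mul_range f, AddMonoidHom.range_eq_top.2 hf, AddSubgroup.card_top]
  congr 1
  obtain ⟨ξ₀, rfl⟩ := hf σ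
  refine Nat.card_congr ((Equiv.addRight (-ξ₀)).subtypeEquiv fun ξ => ?_)
  rw [Equiv.coe_addRight, AddMonoidHom.mem_ker, map_add, map_neg, add_neg_eq_zero]
  rfl

variable [∀ M N : C, Finite (M ⟶ N)] [∀ M N : C, Finite (Ext.{w} M N 1)]

instance (M N R : C) : Finite (SES M N R) := inferInstance

/-- The answer depends only on the corners A and D. Each class in Ext¹(T, D) restricting to σ
contributes |Hom(B ⊞ E, D)|, Riedtmann's formula divides by |Hom(T, D)|, and multiplicativity of the
Euler characteristic along `rimSES` cancels all terms involving T and B ⊞ E. -/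
lemma finsum_card_cross (hher : IsHereditary.{w} C) {A B E D M N M' N' : C}
    (pM : SES A B M) (pN : SES E D N) (pM' : SES A E M') (pN' : SES B D N') :
    ∑ᶠ R : IsoClass C, (Nat.card { x : SES M N R.rep × SES M' N' R.rep //
      IsCross pM pN pM' pN' x } : ℂ) / R.a =
      (Nat.card (Ext.{w} A D 1) : ℂ) / Nat.card (A ⟶ D) := by
  classical
  have (R : C) : Fintype (SES (pullback pM.1.2 pM'.1.2) D R) := Fintype.ofFinite _
  have : Fintype (Ext.{w} (pullback pM.1.2 pM'.1.2) D 1) := Fintype.ofFinite _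
  let σ := (cornerSES pN pN').cls.{w}
  let φ (ξ : Ext.{w} (pullback pM.1.2 pM'.1.2) D 1) : ℂ :=
    if (Ext.mk₀ (rimSES pM pM').1.1).comp ξ (zero_add 1) = σ then
      (Nat.card ((B ⊞ E : C) ⟶ D) : ℂ) else 0
  have h (R : C) : (Nat.card { x : SES M N R × SES M' N' R //
      IsCross pM pN pM' pN' x } : ℂ) =
        ∑ p : SES (pullback pM.1.2 pM'.1.2) D R, φ p.cls := by
    rw [Nat.card_congr (crossEquiv pM pN pM' pN'), Nat.card_sigma, Nat.cast_sum]
    refine Finset.sum_congr rfl fun p _ => ?_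
    rw [card_middle.{w} (cornerSES pN pN').shortExact p.shortExact (rimSES pM pM').1.1]
    rw [Nat.cast_ite, Nat.cast_zero]
    rfl
  simp_rw [h]
  rw [finsum_weighted_SES]
  have h1 : ∑ ξ, φ ξ = (Nat.card { ξ : Ext.{w} (pullback pM.1.2 pM'.1.2) D 1 //
      (Ext.mk₀ (rimSES pM pM').1.1).comp ξ (zero_add 1) = σ } : ℂ) *
        Nat.card ((B ⊞ E : C) ⟶ D) := by
    rw [← Finset.sum_filter, Finset.sum_const, nsmul_eq_mul, Nat.card_eq_fintype_card
      (α := { ξ : Ext.{w} (pullback pM.1.2 pM'.1.2) D 1 // _ }), Fintype.card_subtype]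
  have h2 : (_ : ℂ) = _ :=
    congrArg Nat.cast (card_extensions_restricting.{w} hher (rimSES pM pM') D σ)
  have h3 : (_ : ℂ) = _ :=
    congrArg Nat.cast (card_contravariant.{w} hher D _ (rimSES pM pM').shortExact)
  dsimp only [SES.complex] at h3
  push_cast at h2 h3
  rw [h1, div_eq_div_iff (card_hom_ne_zero _ _) (card_hom_ne_zero _ _)]
  apply mul_right_cancel₀ (card_ext_ne_zero.{w} (B ⊞ E) D)
  rw [← h2] at h3
  linear_combination h3 * (-1 : ℂ)

end FrameCount

/-- The short exact sequence of a subobject and its quotient. -/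
def subSES {M : C} (X : Subobject M) : SES (cokernel X.arrow) (X : C) M :=
  ⟨(X.arrow, cokernel.π X.arrow), cokernel.condition _,
    { exact := ShortComplex.exact_cokernel X.arrow
      mono_f := inferInstanceAs (Mono X.arrow)
      epi_g := inferInstanceAs (Epi (cokernel.π X.arrow)) }⟩

/-- The frames around a `3 × 3` diagram with prescribed first row and column. -/
abbrev Frame (M N M' N' : C) :=
  Σ BD : Subobject M × Subobject N,
    SES (cokernel BD.1.arrow) (cokernel BD.2.arrow) M' × SES (BD.1 : C) (BD.2 : C) N'

lemma subobject_eq_of_epi_mono {X Y : C} {f : X ⟶ Y} {B B' : Subobject Y} (e : X ⟶ (B : C))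
    (e' : X ⟶ (B' : C)) [Epi e] [Epi e'] (h : f = e ≫ B.arrow) (h' : f = e' ≫ B'.arrow) :
    B = B' := by
  have key {B B' : Subobject Y} (e : X ⟶ (B : C)) (e' : X ⟶ (B' : C)) [Epi e]
      (h : e ≫ B.arrow = e' ≫ B'.arrow) : B ≤ B' := by
    have hk : kernel.ι e ≫ e' = 0 := by
      rw [← cancel_mono B'.arrow, Category.assoc, ← h, kernel.condition_assoc]
      simp
    refine Subobject.le_of_comm (Abelian.epiDesc e e' hk) ?_
    rw [← cancel_epi e, Abelian.comp_epiDesc_assoc, h]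
  exact le_antisymm (key e e' (h ▸ h')) (key e' e (h' ▸ h))

lemma subobject_eq_of_SES {M A A' : C} {B B' : Subobject M} (p : SES A (B : C) M)
    (p' : SES A' (B' : C) M) (hp : p.1.1 = B.arrow) (hp' : p'.1.1 = B'.arrow)
    (h : p.1.1 ≫ p'.1.2 = 0) (h' : p'.1.1 ≫ p.1.2 = 0) : B = B' := by
  refine le_antisymm (Subobject.le_of_comm (p'.lift _ h) ?_) (Subobject.le_of_comm (p.lift _ h') ?_)
  · rw [← hp', p'.lift_comp, hp]
  · rw [← hp, p.lift_comp, hp']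

/-! ### Every pair of crossing sequences has exactly one frame -/

section Unique

variable {M N M' N' R : C}

lemma existsUnique_frame (x : SES M N R × SES M' N' R) :
    ∃! y : Frame M N M' N', IsCross (subSES y.1.1) (subSES y.1.2) y.2.1 y.2.2 x := by
  obtain ⟨p, p'⟩ := x
  refine existsUnique_of_exists_of_unique ?_ ?_
  -- B has to be the image of N' → R → M and D the kernel of N → R → M'. The remaining four arrows
  -- are then induced, and only their defining equations matter.
  · obtain ⟨B, e', hepi, hB⟩ : ∃ (B : Subobject M) (e' : N' ⟶ (B : C)), Epi e' ∧
        e' ≫ B.arrow = p'.1.1 ≫ p.1.2 :=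
      ⟨imageSubobject (p'.1.1 ≫ p.1.2), factorThruImageSubobject _, inferInstance,
        imageSubobject_arrow_comp _⟩
    let D := kernelSubobject (p.1.1 ≫ p'.1.2)
    have hD : D.arrow ≫ p.1.1 ≫ p'.1.2 = 0 := kernelSubobject_arrow_comp _
    let j' : cokernel D.arrow ⟶ M' := cokernel.desc D.arrow (p.1.1 ≫ p'.1.2) hD
    have hj' : cokernel.π D.arrow ≫ j' = p.1.1 ≫ p'.1.2 := cokernel.π_desc _ _ _
    let i' : (D : C) ⟶ N' := p'.lift (D.arrow ≫ p.1.1) (by rw [Category.assoc, hD])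
    have hi' : i' ≫ p'.1.1 = D.arrow ≫ p.1.1 := p'.lift_comp _ _
    let q' : M' ⟶ cokernel B.arrow := p'.desc (p.1.2 ≫ cokernel.π B.arrow) (by
      rw [← Category.assoc, ← hB, Category.assoc, cokernel.condition, comp_zero])
    have hq' : p'.1.2 ≫ q' = p.1.2 ≫ cokernel.π B.arrow := p'.comp_desc _ _
    have kD {W : C} (n : W ⟶ N) (hn : n ≫ p.1.1 ≫ p'.1.2 = 0) : ∃ y, n = y ≫ D.arrow :=
      ⟨factorThruKernelSubobject _ n hn, (factorThruKernelSubobject_comp_arrow _ _ _).symm⟩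
    clear_value D j' i' q'
    refine ⟨⟨(B, D), SES.ofRefinements j' q' ?_ ?_ ?_ ?_, SES.ofRefinements i' e' ?_ ?_ ?_ ?_⟩,
      hj'.symm, hB.symm, hi'.symm, hq'.symm⟩
    · rw [← cancel_epi (cokernel.π D.arrow), reassoc_of% hj', hq', reassoc_of% p.zero]
      simp
    · intro W x hx
      obtain ⟨W₁, π, _, n, hn⟩ := (subSES D).exists_refinement x
      change π ≫ x = n ≫ cokernel.π D.arrow at hn
      obtain ⟨y, rfl⟩ := kD n (by rw [← hj', ← reassoc_of% hn, hx, comp_zero])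
      rw [Category.assoc, cokernel.condition, comp_zero] at hn
      exact zero_of_epi_comp π hn
    · intro W x
      obtain ⟨W₁, π, _, m, hm⟩ := (subSES B).exists_refinement x
      obtain ⟨W₂, π₂, _, r, hr⟩ := p.exists_refinement m
      refine ⟨W₂, π₂ ≫ π, epi_comp _ _, r ≫ p'.1.2, ?_⟩
      rw [Category.assoc, hm, Category.assoc, hq', ← reassoc_of% hr]
      rfl
    · intro W x hx
      obtain ⟨W₁, π, _, r, hr⟩ := p'.exists_refinement x
      have h1 : (r ≫ p.1.2) ≫ (subSES B).1.2 = 0 := by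
        rw [Category.assoc]
        change r ≫ p.1.2 ≫ cokernel.π B.arrow = 0
        rw [← hq', ← reassoc_of% hr, hx, comp_zero]
      obtain ⟨W₂, π₂, _, n', hn'⟩ := (epi_iff_surjective_up_to_refinements _).1 hepi
        ((subSES B).lift _ h1)
      have h2 : π₂ ≫ r ≫ p.1.2 = n' ≫ p'.1.1 ≫ p.1.2 := by
        rw [← hB, ← reassoc_of% hn']
        congr 1
        exact ((subSES B).lift_comp _ h1).symm
      have h3 : (π₂ ≫ r - n' ≫ p'.1.1) ≫ p.1.2 = 0 := by
        rw [Preadditive.sub_comp, Category.assoc, Category.assoc, h2, sub_self]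
      refine ⟨W₂, π₂ ≫ π, epi_comp _ _, p.lift _ h3 ≫ cokernel.π D.arrow, ?_⟩
      rw [Category.assoc, Category.assoc, hj', p.lift_comp_assoc, Preadditive.sub_comp,
        Category.assoc, Category.assoc, p'.zero, comp_zero, sub_zero, hr]
    · rw [← cancel_mono B.arrow, Category.assoc, hB, reassoc_of% hi', p.zero, comp_zero, zero_comp]
    · intro W x hx
      have := p.mono
      have h1 : x ≫ D.arrow ≫ p.1.1 = 0 := by rw [← hi', reassoc_of% hx, zero_comp]
      rw [← Category.assoc] at h1
      exact zero_of_comp_mono _ (zero_of_comp_mono _ h1)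
    · exact fun W x => (epi_iff_surjective_up_to_refinements _).1 hepi x
    · intro W x hx
      have h1 : (x ≫ p'.1.1) ≫ p.1.2 = 0 := by
        rw [Category.assoc, ← hB, reassoc_of% hx, zero_comp]
      obtain ⟨y, hy⟩ := kD (p.lift _ h1) (by
        rw [p.lift_comp_assoc, Category.assoc, p'.zero, comp_zero])
      refine ⟨W, 𝟙 W, inferInstance, y, p'.hom_ext_left ?_⟩
      rw [Category.id_comp, Category.assoc, hi', ← reassoc_of% hy, p.lift_comp]
  · rintro ⟨⟨B, D⟩, ⟨⟨j, q⟩, hs⟩, ⟨⟨i, e⟩, ht⟩⟩ ⟨⟨B', D'⟩, ⟨⟨j', q'⟩, hs'⟩, ⟨⟨i', e'⟩, ht'⟩⟩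
      ⟨h1, h2, h3, h4⟩ ⟨h1', h2', h3', h4'⟩
    have := ht.choose_spec.epi_g
    have := ht'.choose_spec.epi_g
    have := hs.choose_spec.mono_f
    have := hs'.choose_spec.mono_f
    dsimp only at *
    obtain rfl : B = B' := subobject_eq_of_epi_mono e e' h2 h2'
    obtain rfl : D = D' := by
      apply subobject_eq_of_SES (subSES D) (subSES D') rfl rfl
      · rw [← cancel_mono j', Category.assoc, ← h1', h1, reassoc_of% (subSES D).zero]
        simp
      · rw [← cancel_mono j, Category.assoc, ← h1, h1', reassoc_of% (subSES D').zero]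
        simp
    obtain rfl : j = j' := (subSES D).hom_ext_right (h1 ▸ h1')
    obtain rfl : e = e' := (subSES B).hom_ext_left (h2 ▸ h2')
    obtain rfl : i = i' := p'.hom_ext_left (h3 ▸ h3')
    obtain rfl : q = q' := p'.hom_ext_right (h4 ▸ h4')
    rfl

end Unique

/-! ### Summing over frames and middle terms -/

section Green

variable [HasExt.{w} C] [∀ M N : C, Finite (M ⟶ N)] [∀ M N : C, Finite (Ext.{w} M N 1)]
  [∀ M : C, Fintype (Subobject M)]

lemma card_SES_mul_card_SES (M N M' N' R : C) [Fintype (Frame M N M' N')] :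
    Nat.card (SES M N R) * Nat.card (SES M' N' R) = ∑ y : Frame M N M' N',
      Nat.card { x : SES M N R × SES M' N' R //
        IsCross (subSES y.1.1) (subSES y.1.2) y.2.1 y.2.2 x } := by
  rw [← Nat.card_prod]
  let F (x : SES M N R × SES M' N' R) : Frame M N M' N' := (existsUnique_frame x).choose
  have hF (x) (y) : F x = y ↔ IsCross (subSES y.1.1) (subSES y.1.2) y.2.1 y.2.2 x := by
    constructor
    · rintro rfl
      exact (existsUnique_frame x).choose_spec.1
    · exact fun h => ((existsUnique_frame x).choose_spec.2 y h).symm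
  rw [← Nat.card_congr (Equiv.sigmaFiberEquiv F), Nat.card_sigma]
  simp_rw [hF]

/-- Green's formula. -/
theorem green (hher : IsHereditary.{w} C) (M N M' N' : C) :
    ∑ᶠ R : IsoClass C,
      (Nat.card (SES M N R.rep) : ℂ) * (Nat.card (SES M' N' R.rep) : ℂ) / R.a =
    ∑ BD : Subobject M × Subobject N,
      (Nat.card (SES (cokernel BD.1.arrow) (cokernel BD.2.arrow) M') : ℂ) *
        (Nat.card (SES (BD.1 : C) (BD.2 : C) N') : ℂ) *
        ((Nat.card (Ext.{w} (cokernel BD.1.arrow) (BD.2 : C) 1) : ℂ) /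
          Nat.card (cokernel BD.1.arrow ⟶ (BD.2 : C))) := by
  have : ∀ M N R : C, Fintype (SES M N R) := fun _ _ _ => Fintype.ofFinite _
  have h (R : C) : (Nat.card (SES M N R) : ℂ) * (Nat.card (SES M' N' R) : ℂ) =
      ∑ y : Frame M N M' N', (Nat.card { x : SES M N R × SES M' N' R //
        IsCross (subSES y.1.1) (subSES y.1.2) y.2.1 y.2.2 x } : ℂ) := by
    exact_mod_cast card_SES_mul_card_SES M N M' N' R
  simp_rw [h, Finset.sum_div]
  rw [finsum_sum_comm]
  -- The contribution of a frame depends only on its pair (B, D), so summing over its two remaining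
  -- sequences just multiplies by their number.
  · simp_rw [finsum_card_cross hher]
    rw [Fintype.sum_sigma]
    refine Finset.sum_congr rfl fun BD _ => ?_
    rw [← Nat.cast_mul, ← Nat.card_prod, Nat.card_eq_fintype_card, ← Finset.card_univ,
      ← nsmul_eq_mul, ← Finset.sum_const]
  · intro y _
    refine (finite_setOf_nonempty_SES M N).subset fun R hR => ?_
    by_contra hne
    have : IsEmpty (SES M N R.rep) := not_nonempty_iff.1 hne
    apply hR
    dsimp only
    rw [Nat.card_of_isEmpty]
    simp

end Green

/-! ### Subobjects and their quotients up to isomorphism -/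

lemma isoClass_eq_of_iso {M N : C} (e : M ≅ N) : isoClass M = isoClass N :=
  isoClass_eq_iff.2 ⟨e⟩

lemma isoClass_cokernel_congr {X X' Y Y' : C} {f : X ⟶ Y} {f' : X' ⟶ Y'} (p : X ≅ X') (q : Y ≅ Y')
    (h : f ≫ q.hom = p.hom ≫ f') : isoClass (cokernel f) = isoClass (cokernel f') :=
  isoClass_eq_of_iso (cokernel.mapIso f f' p q h)

lemma SES.isoClass_cokernel {A B R : C} (p : SES A B R) :
    isoClass (cokernel p.1.1) = isoClass A := by
  have := p.epi
  exact isoClass_eq_of_iso (IsColimit.coconePointUniqueUpToIso (cokernelIsCokernel p.1.1)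
    p.shortExact.gIsCokernel)

/-! ### Subobjects of a subobject -/

section Map

variable {X Y : C} (i : X ⟶ Y) [Mono i]

/-- The underlying object of the image of a subobject under a monomorphism. -/
def mapUnderlyingIso (A : Subobject X) : (A : C) ≅ ((Subobject.map i).obj A : C) :=
  (Subobject.underlyingIso (A.arrow ≫ i)).symm ≪≫ Subobject.isoOfEq _ _ (by
    conv_rhs => rw [← Subobject.mk_arrow A, Subobject.map_mk])

@[simp]
lemma mapUnderlyingIso_hom_arrow (A : Subobject X) :
    (mapUnderlyingIso i A).hom ≫ ((Subobject.map i).obj A).arrow = A.arrow ≫ i := by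
  simp [mapUnderlyingIso]

@[simp]
lemma mapUnderlyingIso_inv_arrow (A : Subobject X) :
    (mapUnderlyingIso i A).inv ≫ A.arrow ≫ i = ((Subobject.map i).obj A).arrow := by
  rw [← mapUnderlyingIso_hom_arrow, Iso.inv_hom_id_assoc]

lemma isoClass_map (A : Subobject X) :
    isoClass ((Subobject.map i).obj A : C) = isoClass (A : C) :=
  isoClass_eq_of_iso (mapUnderlyingIso i A).symm

lemma map_le_map_iff {A B : Subobject X} :
    (Subobject.map i).obj A ≤ (Subobject.map i).obj B ↔ A ≤ B := by
  refine ⟨fun h => ?_, fun h => (Subobject.map i).monotone h⟩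
  refine Subobject.le_of_comm
    ((mapUnderlyingIso i A).hom ≫ Subobject.ofLE _ _ h ≫ (mapUnderlyingIso i B).inv) ?_
  rw [← cancel_mono i]
  simp

lemma exists_map_eq {A : Subobject Y} (h : A ≤ Subobject.mk i) :
    ∃ B : Subobject X, (Subobject.map i).obj B = A := by
  refine ⟨Subobject.mk (Subobject.ofLEMk A i h), ?_⟩
  rw [Subobject.map_mk]
  simp

lemma isoClass_cokernel_map_ofLE {A B : Subobject X} (h : A ≤ B)
    (h' : (Subobject.map i).obj A ≤ (Subobject.map i).obj B) :
    isoClass (cokernel (Subobject.ofLE _ _ h')) = isoClass (cokernel (Subobject.ofLE _ _ h)) := by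
  refine (isoClass_cokernel_congr (mapUnderlyingIso i A) (mapUnderlyingIso i B) ?_).symm
  rw [← cancel_mono ((Subobject.map i).obj B).arrow]
  simp

end Map

lemma isoClass_cokernel_ofLE_congr {M : C} {A A' B B' : Subobject M} (h : A ≤ B) (h' : A' ≤ B')
    (hA : A = A') (hB : B = B') :
    isoClass (cokernel (Subobject.ofLE _ _ h)) = isoClass (cokernel (Subobject.ofLE _ _ h')) := by
  subst hA hB
  rfl

lemma isoClass_cokernel_ofLE_top {M : C} (A : Subobject M) (h : A ≤ ⊤) :
    isoClass (cokernel (Subobject.ofLE _ _ h)) = isoClass (cokernel A.arrow) :=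
  isoClass_cokernel_congr (Iso.refl _) (asIso (⊤ : Subobject M).arrow) (by simp)

/-- A sum over all subobjects of terms depending only on the classes of the subobject and the
quotient is invariant under isomorphisms. -/
lemma sum_subobject_congr {V : Type*} [AddCommMonoid V] [∀ M : C, Fintype (Subobject M)]
    {R R' : C} (e : R ≅ R') (ψ : IsoClass C → IsoClass C → V) :
    ∑ X : Subobject R, ψ (isoClass (cokernel X.arrow)) (isoClass (X : C)) =
      ∑ X : Subobject R', ψ (isoClass (cokernel X.arrow)) (isoClass (X : C)) := by
  refine Fintype.sum_equiv (Subobject.mapIsoToOrderIso e).toEquiv _ _ fun X => ?_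
  change _ = ψ (isoClass (cokernel ((Subobject.map e.hom).obj X).arrow))
    (isoClass ((Subobject.map e.hom).obj X : C))
  rw [isoClass_map, isoClass_cokernel_congr (mapUnderlyingIso e.hom X) e
    (mapUnderlyingIso_hom_arrow _ _).symm]

/-! ### Subobjects of a quotient: the correspondence theorem -/

section Quotient

variable {R : C}

/-- The third isomorphism theorem, as a short exact sequence. -/
def quotientSES (X Y : Subobject R) (h : X ≤ Y) :
    SES (cokernel Y.arrow) (cokernel (Subobject.ofLE X Y h)) (cokernel X.arrow) :=
  SES.ofRefinements
    (cokernel.desc _ (Y.arrow ≫ cokernel.π X.arrow) (by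
      rw [Subobject.ofLE_arrow_assoc, cokernel.condition]))
    (cokernel.desc _ (cokernel.π Y.arrow) (by
      rw [← Subobject.ofLE_arrow h, Category.assoc, cokernel.condition, comp_zero]))
    (by
      rw [← cancel_epi (cokernel.π _)]
      simp)
    (by
      intro W x hx
      obtain ⟨W₁, π, _, y, hy⟩ :=
        (epi_iff_surjective_up_to_refinements (cokernel.π (Subobject.ofLE X Y h))).1 inferInstance x
      have h1 : (y ≫ Y.arrow) ≫ (subSES X).1.2 = 0 := by
        have := π ≫= hx
        rw [reassoc_of% hy, cokernel.π_desc, comp_zero] at this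
        rw [Category.assoc]
        exact this
      have h2 : y = (subSES X).lift _ h1 ≫ Subobject.ofLE X Y h := by
        rw [← cancel_mono Y.arrow, Category.assoc, Subobject.ofLE_arrow]
        exact ((subSES X).lift_comp _ h1).symm
      rw [h2, Category.assoc, cokernel.condition, comp_zero] at hy
      exact zero_of_epi_comp π hy)
    (fun W x => (epi_iff_surjective_up_to_refinements _).1
      (by
        have : Epi (cokernel.π X.arrow ≫ cokernel.desc X.arrow (cokernel.π Y.arrow) (by
            rw [← Subobject.ofLE_arrow h, Category.assoc, cokernel.condition, comp_zero])) := by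
          rw [cokernel.π_desc]
          infer_instance
        exact epi_of_epi (cokernel.π X.arrow) _) x)
    (by
      intro W x hx
      obtain ⟨W₁, π, _, r, hr⟩ :=
        (epi_iff_surjective_up_to_refinements (cokernel.π X.arrow)).1 inferInstance x
      have h1 : r ≫ (subSES Y).1.2 = 0 := by
        have := π ≫= hx
        rwa [reassoc_of% hr, cokernel.π_desc, comp_zero] at this
      refine ⟨W₁, π, inferInstance, (subSES Y).lift r h1 ≫ cokernel.π _, ?_⟩
      rw [Category.assoc, cokernel.π_desc, hr, ← Category.assoc]
      congr 1
      exact ((subSES Y).lift_comp r h1).symm)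

lemma isoClass_mk {A B : C} (p : SES A B R) (Z : Subobject R) [Mono p.1.1]
    (hZ : Subobject.mk p.1.1 = Z) :
    isoClass (Z : C) = isoClass B ∧ isoClass (cokernel Z.arrow) = isoClass A := by
  subst hZ
  refine ⟨isoClass_eq_of_iso (Subobject.underlyingIso _), ?_⟩
  rw [← p.isoClass_cokernel]
  exact isoClass_cokernel_congr (Subobject.underlyingIso _) (Iso.refl _) (by simp)

/-- The image of a subobject containing `X` in the quotient by `X`. -/
def quotientSub (X : Subobject R) (Y : Set.Ici X) : Subobject (cokernel X.arrow) :=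
  have := (quotientSES X Y.1 Y.2).mono
  Subobject.mk (quotientSES X Y.1 Y.2).1.1

lemma quotientSub_comp {X : Subobject R} (Y : Set.Ici X) :
    (quotientSub X Y).arrow ≫ (quotientSES X Y.1 Y.2).1.2 = 0 := by
  have := (quotientSES X Y.1 Y.2).mono
  unfold quotientSub
  rw [← Subobject.underlyingIso_hom_comp_eq_mk, Category.assoc, SES.zero, comp_zero]

/-- The inverse sends Z to its preimage in R, the kernel of R → R/X → (R/X)/Z. Injectivity holds
because Y is recovered from Y/X as the kernel of R → R/Y. -/
lemma quotientSub_bijective (X : Subobject R) : Function.Bijective (quotientSub X) := by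
  constructor
  · have key (Y Y' : Set.Ici X) (h : quotientSub X Y = quotientSub X Y') : Y ≤ Y' := by
      have h1 := quotientSub_comp Y'
      rw [← h] at h1
      have := (quotientSES X Y.1 Y.2).mono
      have h2 : (quotientSES X Y.1 Y.2).1.1 ≫ (quotientSES X Y'.1 Y'.2).1.2 = 0 := by
        rw [← Subobject.underlyingIso_arrow (quotientSES X Y.1 Y.2).1.1, Category.assoc]
        exact (_ ≫= h1).trans comp_zero
      have h3 : Y.1.arrow ≫ (subSES Y'.1).1.2 = 0 := by
        have := cokernel.π (Subobject.ofLE X Y.1 Y.2) ≫= h2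
        simpa [quotientSES, SES.ofRefinements, subSES] using this
      exact Subobject.le_of_comm ((subSES Y'.1).lift _ h3) ((subSES Y'.1).lift_comp _ h3)
    exact fun Y Y' h => le_antisymm (key Y Y' h) (key Y' Y h.symm)
  · intro Z
    let Y := kernelSubobject (cokernel.π X.arrow ≫ cokernel.π Z.arrow)
    have hY : Y.arrow ≫ cokernel.π X.arrow ≫ cokernel.π Z.arrow = 0 :=
      kernelSubobject_arrow_comp _
    have hXY : X ≤ Y := Subobject.le_of_comm
      (factorThruKernelSubobject _ X.arrow (by rw [cokernel.condition_assoc, zero_comp]))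
      (factorThruKernelSubobject_comp_arrow _ _ _)
    refine ⟨⟨Y, hXY⟩, ?_⟩
    have := (quotientSES X Y hXY).mono
    have h1 : (quotientSES X Y hXY).1.1 ≫ (subSES Z).1.2 = 0 := by
      rw [← cancel_epi (cokernel.π _)]
      simpa [quotientSES, SES.ofRefinements, subSES] using hY
    have hd : ∃ d : cokernel Y.arrow ⟶ cokernel Z.arrow,
        (quotientSES X Y hXY).1.2 ≫ d = (subSES Z).1.2 :=
      ⟨(quotientSES X Y hXY).desc _ h1, (quotientSES X Y hXY).comp_desc _ h1⟩
    have h2 : Z.arrow ≫ (quotientSES X Y hXY).1.2 = 0 := by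
      obtain ⟨W₁, π, _, r, hr⟩ :=
        (epi_iff_surjective_up_to_refinements (cokernel.π X.arrow)).1 inferInstance Z.arrow
      have h3 : r ≫ cokernel.π X.arrow ≫ cokernel.π Z.arrow = 0 := by
        rw [← reassoc_of% hr, cokernel.condition, comp_zero]
      have h4 : r = factorThruKernelSubobject _ r h3 ≫ Y.arrow :=
        (factorThruKernelSubobject_comp_arrow _ _ _).symm
      rw [← cancel_epi π, reassoc_of% hr, comp_zero]
      change r ≫ cokernel.π X.arrow ≫ cokernel.desc _ _ _ = 0
      rw [cokernel.π_desc, h4, Category.assoc, cokernel.condition, comp_zero]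
    refine le_antisymm ?_ ?_
    · refine Subobject.mk_le_of_comm ((subSES Z).lift _ h1) ((subSES Z).lift_comp _ h1)
    · refine Subobject.le_mk_of_comm ((quotientSES X Y hXY).lift _ h2)
        ((quotientSES X Y hXY).lift_comp _ h2)

end Quotient

/-! ### Two ways of summing over flags -/

section Flags

variable [∀ M : C, Fintype (Subobject M)] {V : Type*} [AddCommMonoid V]

lemma sum_subobject_underlying {R : C} (Y : Subobject R)
    (ψ : IsoClass C → IsoClass C → V) [Fintype (Set.Iic Y)] :
    ∑ X' : Subobject (Y : C), ψ (isoClass (cokernel X'.arrow)) (isoClass (X' : C)) =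
      ∑ X : Set.Iic Y, ψ (isoClass (cokernel (Subobject.ofLE X.1 Y X.2))) (isoClass (X.1 : C)) := by
  have hle (X' : Subobject (Y : C)) : (Subobject.map Y.arrow).obj X' ≤ Y :=
    Subobject.le_of_comm ((mapUnderlyingIso Y.arrow X').inv ≫ X'.arrow) (by
      rw [Category.assoc, mapUnderlyingIso_inv_arrow])
  have hbij : Function.Bijective fun X' => (⟨_, hle X'⟩ : Set.Iic Y) := by
    refine ⟨fun A B h => Subobject.map_obj_injective Y.arrow (congrArg Subtype.val h), ?_⟩
    rintro ⟨X, hX⟩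
    obtain ⟨B, hB⟩ := exists_map_eq Y.arrow (A := X) (by rw [Subobject.mk_arrow]; exact hX)
    exact ⟨B, Subtype.ext hB⟩
  rw [← hbij.sum_comp]
  refine Finset.sum_congr rfl fun X' _ => ?_
  dsimp only
  rw [isoClass_map, isoClass_cokernel_congr (mapUnderlyingIso Y.arrow X') (Iso.refl _)]
  rw [← cancel_mono Y.arrow, Category.assoc, Category.assoc, Iso.refl_hom, Category.id_comp]
  exact (mapUnderlyingIso_hom_arrow _ _).symm.trans
    (congrArg (_ ≫ ·) (Subobject.ofLE_arrow (hle X')).symm)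

/-- The correspondence theorem, with the quotient (R/X)/(Y/X) identified with R/Y. -/
lemma sum_subobject_cokernel {R : C} (X : Subobject R)
    (ψ : IsoClass C → IsoClass C → V) [Fintype (Set.Ici X)] :
    ∑ Y' : Subobject (cokernel X.arrow), ψ (isoClass (cokernel Y'.arrow)) (isoClass (Y' : C)) =
      ∑ Y : Set.Ici X, ψ (isoClass (cokernel Y.1.arrow))
        (isoClass (cokernel (Subobject.ofLE X Y.1 Y.2))) := by
  rw [← (quotientSub_bijective X).sum_comp]
  refine Finset.sum_congr rfl fun Y _ => ?_
  have := (quotientSES X Y.1 Y.2).mono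
  obtain ⟨h1, h2⟩ := isoClass_mk (quotientSES X Y.1 Y.2) (quotientSub X Y) rfl
  rw [h1, h2]

/-- Both sides sum over the flags `X ≤ Y` of subobjects of `R`. -/
lemma sum_flags (R : C) (ψ : IsoClass C → IsoClass C → IsoClass C → V) :
    ∑ X : Subobject R, ∑ Y' : Subobject (cokernel X.arrow),
      ψ (isoClass (cokernel Y'.arrow)) (isoClass (Y' : C)) (isoClass (X : C)) =
    ∑ Y : Subobject R, ∑ X' : Subobject (Y : C),
      ψ (isoClass (cokernel Y.arrow)) (isoClass (cokernel X'.arrow)) (isoClass (X' : C)) := by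
  classical
  rw [Finset.sum_congr rfl fun X _ =>
      sum_subobject_cokernel X (fun A B => ψ A B (isoClass (X : C))),
    Finset.sum_congr rfl fun Y _ =>
      sum_subobject_underlying Y (fun A B => ψ (isoClass (cokernel Y.arrow)) A B)]
  rw [Finset.sum_sigma', Finset.sum_sigma', Finset.univ_sigma_univ, Finset.univ_sigma_univ]
  exact Fintype.sum_equiv
    { toFun := fun p => ⟨p.2.1, p.1, p.2.2⟩
      invFun := fun p => ⟨p.2.1, p.1, p.2.2⟩
      left_inv := fun _ => rfl
      right_inv := fun _ => rfl } _ _ fun _ => rfl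

end Flags

/-! ### Hall numbers -/

lemma k0Class_zero : k0Class (0 : C) = 0 := by
  let q : SES (0 : C) (0 : C) (0 : C) := ⟨(0, 0), by simp,
    { exact := ShortComplex.exact_of_isZero_X₂ _ (isZero_zero C)
      mono_f := ⟨fun _ _ _ => (isZero_zero C).eq_of_tgt _ _⟩
      epi_g := ⟨fun _ _ _ => (isZero_zero C).eq_of_src _ _⟩ }⟩
  exact left_eq_add.1 q.k0Class_eq

lemma k0Class_eq_of_iso {M N : C} (e : M ≅ N) : k0Class M = k0Class N := by
  have hS : (ShortComplex.mk e.hom (0 : N ⟶ (0 : C)) comp_zero).ShortExact :=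
    { exact := (ShortComplex.exact_iff_epi _ rfl).2 (inferInstanceAs (Epi e.hom))
      mono_f := inferInstanceAs (Mono e.hom)
      epi_g := ⟨fun _ _ _ => (isZero_zero C).eq_of_src _ _⟩ }
  let p : SES (0 : C) M N := ⟨(e.hom, 0), comp_zero, hS⟩
  rw [p.k0Class_eq, k0Class_zero, add_zero]

lemma k0_isoClass (M : C) : (isoClass M).k0 = k0Class M :=
  k0Class_eq_of_iso (nonempty_rep_iso M).some

lemma k0_isoClass_zero : (isoClass (0 : C)).k0 = 0 := by
  rw [k0_isoClass, k0Class_zero]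

lemma card_iso_congr {M N M' N' : C} (e : M ≅ M') (f : N ≅ N') :
    Nat.card (M ≅ N) = Nat.card (M' ≅ N') :=
  Nat.card_congr ⟨fun g => e.symm ≪≫ g ≪≫ f, fun g => e ≪≫ g ≪≫ f.symm,
    fun g => by ext; simp, fun g => by ext; simp⟩

lemma a_isoClass (M : C) : (isoClass M).a = Nat.card (Aut M) :=
  card_iso_congr (nonempty_rep_iso M).some (nonempty_rep_iso M).some

lemma card_iso_eq_a {M N : C} (e : M ≅ N) : Nat.card (M ≅ N) = (isoClass M).a := by
  rw [a_isoClass]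
  exact card_iso_congr (Iso.refl M) e.symm

lemma k0Class_subobject {R : C} (X : Subobject R) :
    k0Class R = (isoClass (X : C)).k0 + (isoClass (cokernel X.arrow)).k0 := by
  rw [(subSES X).k0Class_eq, k0_isoClass, k0_isoClass]

section Count

variable [∀ M N : C, Finite (M ⟶ N)] [∀ M : C, Fintype (Subobject M)]

/-- The number of subobjects with prescribed class and class of the quotient. -/
def hallG (R : C) (M N : IsoClass C) : ℕ :=
  Nat.card { X : Subobject R // isoClass (cokernel X.arrow) = M ∧ isoClass (X : C) = N }

/-- A short exact sequence is a subobject together with identifications of the subobject and of the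
quotient. -/
lemma ofSubobject_bijective (A B R : C) : Function.Bijective
    (fun x : Σ X : { X : Subobject R // isoClass (cokernel X.arrow) = isoClass A ∧
        isoClass (X : C) = isoClass B }, (cokernel X.1.arrow ≅ A) × ((X.1 : C) ≅ B) =>
      SES.congr x.2.1 x.2.2 (Iso.refl R) (subSES x.1.1)) := by
  constructor
  · rintro ⟨⟨X, hX⟩, ψ, φ⟩ ⟨⟨X', hX'⟩, ψ', φ'⟩ h
    have h1 : φ.inv ≫ X.arrow = φ'.inv ≫ X'.arrow := by
      simpa [SES.congr, subSES] using congrArg (fun p : SES A B R => p.1.1) h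
    have h2 : cokernel.π X.arrow ≫ ψ.hom = cokernel.π X'.arrow ≫ ψ'.hom := by
      simpa [SES.congr, subSES] using congrArg (fun p : SES A B R => p.1.2) h
    obtain rfl : X = X' := Subobject.eq_of_comm (φ ≪≫ φ'.symm) (by simp [← h1])
    have h3 : φ.inv = φ'.inv := (cancel_mono X.arrow).1 h1
    have h4 : ψ.hom = ψ'.hom := (cancel_epi (cokernel.π X.arrow)).1 h2
    obtain rfl : φ = φ' := by
      rw [← Iso.symm_eq_iff]; exact Iso.ext h3
    obtain rfl : ψ = ψ' := Iso.ext h4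
    rfl
  · intro p
    have := p.mono
    have hX := isoClass_mk p (Subobject.mk p.1.1) rfl
    let q := subSES (Subobject.mk p.1.1)
    have hq : p.1.1 = (Subobject.underlyingIso p.1.1).inv ≫ q.1.1 :=
      (Subobject.underlyingIso_arrow _).symm
    have hq' : q.1.1 = (Subobject.underlyingIso p.1.1).hom ≫ p.1.1 :=
      (Subobject.underlyingIso_hom_comp_eq_mk _).symm
    let ψ : cokernel (Subobject.mk p.1.1).arrow ≅ A :=
      { hom := q.desc p.1.2 (by rw [hq', Category.assoc, p.zero, comp_zero])
        inv := p.desc q.1.2 ((hq =≫ q.1.2).trans (by rw [Category.assoc, q.zero, comp_zero]))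
        hom_inv_id := q.hom_ext_right (by simp)
        inv_hom_id := p.hom_ext_right (by simp) }
    refine ⟨⟨⟨Subobject.mk p.1.1, hX.2, hX.1⟩, ψ, Subobject.underlyingIso _⟩, ?_⟩
    ext
    · simp [SES.congr, subSES]
    · simp only [SES.congr, Equiv.coe_fn_mk, Iso.refl_inv, Category.id_comp]
      exact q.comp_desc _ _

/-- Over each admissible subobject the identifications with A and B form torsors under Aut(A) and
Aut(B). -/
lemma card_SES (A B R : C) : Nat.card (SES A B R) =
    hallG R (isoClass A) (isoClass B) * ((isoClass A).a * (isoClass B).a) := by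
  classical
  have (M N : C) : Finite (M ≅ N) :=
    Finite.of_injective (fun e => e.hom) (fun _ _ h => Iso.ext h)
  rw [← Nat.card_congr (Equiv.ofBijective _ (ofSubobject_bijective A B R)), Nat.card_sigma]
  have h (X : { X : Subobject R // isoClass (cokernel X.arrow) = isoClass A ∧
      isoClass (X : C) = isoClass B }) :
      Nat.card ((cokernel X.1.arrow ≅ A) × ((X.1 : C) ≅ B)) =
        (isoClass A).a * (isoClass B).a := by
    obtain ⟨X, hA, hB⟩ := X
    rw [Nat.card_prod, card_iso_eq_a (isoClass_eq_iff.1 hA).some,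
      card_iso_eq_a (isoClass_eq_iff.1 hB).some, hA, hB]
  simp only [h, Finset.sum_const, smul_eq_mul, Finset.card_univ, hallG,
    Nat.card_eq_fintype_card]

lemma hallP_eq_card_SES (R M N : IsoClass C) :
    hallP R M N = Nat.card (SES M.rep N.rep R.rep) := rfl

lemma hallP_eq (R M N : IsoClass C) : hallP R M N = hallG R.rep M N * (M.a * N.a) := by
  rw [hallP_eq_card_SES, card_SES, isoClass_rep, isoClass_rep]

open Classical in
lemma hallG_eq_sum (R : C) (M N : IsoClass C) :
    (hallG R M N : ℂ) = ∑ X : Subobject R,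
      if isoClass (cokernel X.arrow) = M ∧ isoClass (X : C) = N then (1 : ℂ) else 0 := by
  rw [← Finset.sum_filter, Finset.sum_const, nsmul_eq_mul, mul_one, hallG,
    Nat.card_eq_fintype_card, Fintype.card_subtype]

lemma hallG_congr {R R' : C} (e : R ≅ R') (M N : IsoClass C) : hallG R M N = hallG R' M N := by
  classical
  have : (hallG R M N : ℂ) = hallG R' M N := by
    rw [hallG_eq_sum, hallG_eq_sum]
    exact sum_subobject_congr e fun A B => if A = M ∧ B = N then (1 : ℂ) else 0
  exact_mod_cast this

lemma nonempty_SES_of_hallG_ne_zero {R : C} {A B : C}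
    (h : hallG R (isoClass A) (isoClass B) ≠ 0) : Nonempty (SES A B R) := by
  obtain ⟨⟨X, hA, hB⟩⟩ := (Nat.card_ne_zero.1 h).1
  exact ⟨SES.congr (isoClass_eq_iff.1 hA).some (isoClass_eq_iff.1 hB).some (Iso.refl R) (subSES X)⟩

lemma k0_eq_of_hallG_ne_zero {R : C} {M N : IsoClass C} (h : hallG R M N ≠ 0) :
    k0Class R = M.k0 + N.k0 := by
  obtain ⟨⟨X, rfl, rfl⟩⟩ := (Nat.card_ne_zero.1 h).1
  rw [k0Class_subobject X, add_comm]

lemma hallP_ne_zero_iff (R M N : IsoClass C) : hallP R M N ≠ 0 ↔ hallG R.rep M N ≠ 0 := by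
  have h1 : M.a ≠ 0 := by exact_mod_cast a_ne_zero M
  have h2 : N.a ≠ 0 := by exact_mod_cast a_ne_zero N
  rw [hallP_eq]
  simp [h1, h2]

lemma finite_setOf_hallG_ne_zero (R : C) :
    {MN : IsoClass C × IsoClass C | hallG R MN.1 MN.2 ≠ 0}.Finite := by
  refine (Set.finite_range fun X : Subobject R =>
    (isoClass (cokernel X.arrow), isoClass (X : C))).subset ?_
  rintro ⟨M, N⟩ h
  obtain ⟨⟨X, rfl, rfl⟩⟩ := (Nat.card_ne_zero.1 h).1
  exact ⟨X, rfl⟩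

/-- A weighted sum over classes of subobjects and quotients is a sum over subobjects. -/
lemma finsum_hallG {V : Type*} [AddCommGroup V] [Module ℂ V] (R : C)
    (ψ : IsoClass C × IsoClass C → V) :
    ∑ᶠ MN : IsoClass C × IsoClass C, (hallG R MN.1 MN.2 : ℂ) • ψ MN =
      ∑ X : Subobject R, ψ (isoClass (cokernel X.arrow), isoClass (X : C)) := by
  classical
  have h (MN : IsoClass C × IsoClass C) : (hallG R MN.1 MN.2 : ℂ) • ψ MN =
      ∑ X : Subobject R, if (isoClass (cokernel X.arrow), isoClass (X : C)) = MN then ψ MN else 0 := by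
    rw [hallG_eq_sum, Finset.sum_smul]
    refine Finset.sum_congr rfl fun X _ => ?_
    simp only [Prod.ext_iff, ite_smul, one_smul, zero_smul]
  simp_rw [h]
  rw [finsum_sum_comm]
  · refine Finset.sum_congr rfl fun X _ => ?_
    rw [finsum_eq_single _ (isoClass (cokernel X.arrow), isoClass (X : C)), if_pos rfl]
    exact fun MN hMN => if_neg hMN.symm
  · intro X _
    refine (Set.finite_singleton (isoClass (cokernel X.arrow), isoClass (X : C))).subset ?_
    intro MN hMN
    by_contra hne
    exact hMN (if_neg fun h => hne h.symm)

end Count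

/-! ### The Euler form -/

namespace EulerRoot

variable [HasExt.{w} C] (χ : EulerRoot.{w} C)

lemma pair_add_left (α β γ : K0 C) : χ.pair (α + β) γ = χ.pair α γ * χ.pair β γ := by
  simp [pair]

lemma pair_add_right (α β γ : K0 C) : χ.pair α (β + γ) = χ.pair α β * χ.pair α γ := by
  simp [pair]

@[simp] lemma pair_zero_left (α : K0 C) : χ.pair 0 α = 1 := by simp [pair]

@[simp] lemma pair_zero_right (α : K0 C) : χ.pair α 0 = 1 := by simp [pair]

lemma pair_ne_zero (α β : K0 C) : χ.pair α β ≠ 0 := Units.ne_zero _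

lemma pair_sq (M N : C) : χ.pair (k0Class M) (k0Class N) ^ 2 =
    (Nat.card (M ⟶ N) : ℂ) / (Nat.card (Ext.{w} M N 1) : ℂ) := χ.form_sq M N

lemma symm_add_left (α β γ : K0 C) : χ.symm (α + β) γ = χ.symm α γ * χ.symm β γ := by
  simp only [symm, pair_add_left, pair_add_right]; ring

lemma symm_add_right (α β γ : K0 C) : χ.symm α (β + γ) = χ.symm α β * χ.symm α γ := by
  simp only [symm, pair_add_left, pair_add_right]; ring

@[simp] lemma symm_zero_left (α : K0 C) : χ.symm 0 α = 1 := by simp [symm]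

@[simp] lemma symm_zero_right (α : K0 C) : χ.symm α 0 = 1 := by simp [symm]

end EulerRoot

/-! ### Zero objects and trivial subobjects -/

lemma isoClass_eq_zero_iff {M : C} : isoClass M = isoClass (0 : C) ↔ IsZero M := by
  rw [isoClass_eq_iff]
  exact ⟨fun ⟨e⟩ => (isZero_zero C).of_iso e, fun h => ⟨h.isoZero⟩⟩

lemma isoClass_cokernel_eq_zero_iff {M : C} (X : Subobject M) :
    isoClass (cokernel X.arrow) = isoClass (0 : C) ↔ X = ⊤ := by
  rw [isoClass_eq_zero_iff]
  constructor
  · intro h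
    have : Epi X.arrow := Preadditive.epi_of_isZero_cokernel _ h
    have : IsIso X.arrow := isIso_of_mono_of_epi _
    exact Subobject.eq_top_of_isIso_arrow X
  · rintro rfl
    exact isZero_cokernel_of_epi _

lemma isoClass_top {M : C} : isoClass ((⊤ : Subobject M) : C) = isoClass M :=
  isoClass_eq_of_iso (asIso (⊤ : Subobject M).arrow)

lemma isoClass_cokernel_top {M : C} :
    isoClass (cokernel (⊤ : Subobject M).arrow) = isoClass (0 : C) :=
  (isoClass_cokernel_eq_zero_iff _).2 rfl

lemma isoClass_bot {M : C} : isoClass ((⊥ : Subobject M) : C) = isoClass (0 : C) :=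
  isoClass_eq_of_iso Subobject.botCoeIsoZero

lemma isoClass_cokernel_bot {M : C} :
    isoClass (cokernel (⊥ : Subobject M).arrow) = isoClass M := by
  rw [isoClass_cokernel_congr (f' := (0 : (0 : C) ⟶ M)) Subobject.botCoeIsoZero (Iso.refl M)
    (by simp)]
  exact isoClass_eq_of_iso cokernelZeroIsoTarget

lemma isoClass_subobject_eq_zero_iff {M : C} (X : Subobject M) :
    isoClass (X : C) = isoClass (0 : C) ↔ X = ⊥ := by
  rw [isoClass_eq_zero_iff]
  constructor
  · intro h
    exact le_bot_iff.1 (Subobject.le_of_comm (0 : (X : C) ⟶ _) (h.eq_of_src _ _))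
  · rintro rfl
    exact (isZero_zero C).of_iso Subobject.botCoeIsoZero

/-! ### Reduction to basis elements -/

section Basis

lemma induction_elt {P : ExtHall C → Prop} (x : ExtHall C) (h0 : P 0)
    (hadd : ∀ x y, P x → P y → P (x + y)) (hsmul : ∀ (c : ℂ) (x), P x → P (c • x))
    (helt : ∀ (M : C) (α : K0 C), P (elt (isoClass M) α)) : P x := by
  induction x using Finsupp.induction_linear with
  | zero => exact h0
  | add x y hx hy => exact hadd x y hx hy
  | single p c =>
    have := hsmul c _ (helt p.1.rep p.2)
    rwa [isoClass_rep, elt, Finsupp.smul_single, smul_eq_mul, mul_one] at this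

lemma hom_ext_elt {V : Type*} [AddCommMonoid V] [Module ℂ V] {f g : ExtHall C →ₗ[ℂ] V}
    (h : ∀ (M : C) (α : K0 C), f (elt (isoClass M) α) = g (elt (isoClass M) α)) : f = g := by
  refine LinearMap.ext fun x => ?_
  induction x using induction_elt with
  | h0 => simp
  | hadd x y hx hy => simp [hx, hy]
  | hsmul c x hx => simp [hx]
  | helt M α => exact h M α

open Classical in
lemma counit_elt (M : IsoClass C) (α : K0 C) :
    counit C (elt M α) = if M = isoClass (0 : C) then 1 else 0 := by
  simp [counit, elt]

end Basis

/-! ### Structure maps in terms of subobjects, associativity and coassociativity -/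

section Formulas

variable [∀ M N : C, Finite (M ⟶ N)] [∀ M : C, Fintype (Subobject M)]
  [HasExt.{w} C] [∀ M N : C, Finite (Ext.{w} M N 1)] (χ : EulerRoot.{w} C)

/-- The coefficient `⟨M, N⟩ₘ a_M a_N / a_R` in the coproduct. -/
def comulCoeff (R M N : IsoClass C) : ℂ :=
  χ.pair M.k0 N.k0 * ((M.a : ℂ) * (N.a : ℂ) / (R.a : ℂ))

/-- The coproduct as a sum over subobjects. -/
lemma comul_elt (R : C) (α : K0 C) :
    comul χ (elt (isoClass R) α) = ∑ X : Subobject R,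
      comulCoeff χ (isoClass R) (isoClass (cokernel X.arrow)) (isoClass (X : C)) •
        (elt (isoClass (cokernel X.arrow)) ((isoClass (X : C)).k0 + α) ⊗ₜ[ℂ]
          elt (isoClass (X : C)) α) := by
  obtain ⟨e⟩ := nonempty_rep_iso R
  rw [← sum_subobject_congr e (fun A B => comulCoeff χ (isoClass R) A B •
    (elt A (B.k0 + α) ⊗ₜ[ℂ] elt B α)), ← finsum_hallG (isoClass R).rep
    (fun MN => comulCoeff χ (isoClass R) MN.1 MN.2 •
      (elt MN.1 (MN.2.k0 + α) ⊗ₜ[ℂ] elt MN.2 α))]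
  rw [comul, elt, Finsupp.linearCombination_single, one_smul]
  refine finsum_congr fun MN => ?_
  rw [smul_smul, hallP_eq, comulCoeff]
  congr 1
  push_cast
  ring

lemma finite_setOf_hallG_ne_zero' (M N : IsoClass C) :
    {R : IsoClass C | hallG R.rep M N ≠ 0}.Finite := by
  refine (finite_setOf_nonempty_SES.{w} M.rep N.rep).subset fun R hR => ?_
  rw [Set.mem_ofPred_eq, ← isoClass_rep M, ← isoClass_rep N] at hR
  exact nonempty_SES_of_hallG_ne_zero hR

lemma mul_elt (M N : IsoClass C) (α β : K0 C) :
    mul χ (elt M α) (elt N β) = ∑ᶠ R : IsoClass C,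
      (χ.symm α N.k0 * χ.pair M.k0 N.k0 * (hallG R.rep M N : ℂ)) • elt R (α + β) := by
  rw [mul, elt, elt, Finsupp.linearCombination_single, one_smul,
    Finsupp.linearCombination_single, one_smul]
  refine finsum_congr fun R => ?_
  rw [hallP_eq]
  congr 2
  have h1 := a_ne_zero M
  have h2 := a_ne_zero N
  push_cast
  field_simp

lemma mul_elt_sum (M N : IsoClass C) (α β : K0 C) (s : Finset (IsoClass C))
    (hs : ∀ R, hallG R.rep M N ≠ 0 → R ∈ s) :
    mul χ (elt M α) (elt N β) = (χ.symm α N.k0 * χ.pair M.k0 N.k0) •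
      ∑ R ∈ s, (hallG R.rep M N : ℂ) • elt R (α + β) := by
  rw [mul_elt, finsum_eq_sum_of_support_subset (s := s), Finset.smul_sum]
  · simp only [smul_smul]
  · intro R hR
    refine hs R fun h => hR ?_
    dsimp only
    rw [h, Nat.cast_zero, mul_zero, zero_smul]

/-- The classes of extensions of `M` by `N`. -/
def extensions (M N : IsoClass C) : Finset (IsoClass C) :=
  (finite_setOf_hallG_ne_zero'.{w} M N).toFinset

lemma hallG_zero_left (R : C) (N : IsoClass C) [Decidable (isoClass R = N)] :
    hallG R (isoClass (0 : C)) N = if isoClass R = N then 1 else 0 := by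
  classical
  have : (hallG R (isoClass (0 : C)) N : ℂ) = if isoClass R = N then 1 else 0 := by
    rw [hallG_eq_sum, Finset.sum_eq_single (⊤ : Subobject R)]
    · simp [isoClass_cokernel_top, isoClass_top]
    · intro X _ hX
      rw [if_neg]
      rw [isoClass_cokernel_eq_zero_iff]
      exact fun h => hX h.1
    · simp
  split_ifs at this ⊢ <;> exact_mod_cast this

lemma hallG_zero_right (R : C) (M : IsoClass C) [Decidable (isoClass R = M)] :
    hallG R M (isoClass (0 : C)) = if isoClass R = M then 1 else 0 := by
  classical
  have : (hallG R M (isoClass (0 : C)) : ℂ) = if isoClass R = M then 1 else 0 := by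
    rw [hallG_eq_sum, Finset.sum_eq_single (⊥ : Subobject R)]
    · rw [isoClass_cokernel_bot, isoClass_bot]
      simp
    · intro X _ hX
      rw [if_neg]
      rw [isoClass_subobject_eq_zero_iff]
      exact fun h => hX h.2
    · simp
  split_ifs at this ⊢ <;> exact_mod_cast this

lemma kElt_mul_elt (N : IsoClass C) (α β : K0 C) :
    mul χ (kElt α) (elt N β) = χ.symm α N.k0 • elt N (α + β) := by
  classical
  rw [kElt, mul_elt_sum χ _ _ _ _ {N}]
  · simp [hallG_zero_left, isoClass_rep, k0_isoClass_zero]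
  · intro R hR
    rw [hallG_zero_left, isoClass_rep] at hR
    simpa using hR

lemma elt_mul_kElt (M : IsoClass C) (α β : K0 C) :
    mul χ (elt M α) (kElt β) = elt M (α + β) := by
  classical
  rw [kElt, mul_elt_sum χ _ _ _ _ {M}]
  · simp [hallG_zero_right, isoClass_rep, k0_isoClass_zero]
  · intro R hR
    rw [hallG_zero_right, isoClass_rep] at hR
    simpa using hR

lemma one_mul_hall (x : ExtHall C) : mul χ (one C) x = x := by
  have : mul χ (one C) = LinearMap.id := hom_ext_elt fun M α => by
    simpa using! kElt_mul_elt χ (isoClass M) 0 α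
  rw [this, LinearMap.id_apply]

lemma mul_one_hall (x : ExtHall C) : mul χ x (one C) = x := by
  have : (mul χ).flip (one C) = LinearMap.id := hom_ext_elt fun M α => by
    simpa using! elt_mul_kElt χ (isoClass M) α 0
  exact LinearMap.congr_fun this x

/-- Grouping subobjects by the class Q of their quotient; enlarging `s` beyond the support of F
changes nothing. -/
lemma sum_mul_hallG_left (R : C) (N : IsoClass C) (F : IsoClass C → ℂ) (s : Finset (IsoClass C))
    (hs : ∀ Q, F Q ≠ 0 → Q ∈ s) [DecidableEq (IsoClass C)] :
    ∑ Q ∈ s, F Q * hallG R Q N =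
      ∑ X : Subobject R, if isoClass (X : C) = N then F (isoClass (cokernel X.arrow)) else 0 := by
  classical
  simp only [hallG_eq_sum, Finset.mul_sum]
  rw [Finset.sum_comm]
  refine Finset.sum_congr rfl fun X _ => ?_
  simp only [ite_and, mul_ite, mul_one, mul_zero, Finset.sum_ite_eq]
  split_ifs with h1 h2 <;> first | rfl | skip
  exact (not_not.1 fun h => h1 (hs _ h)).symm

lemma sum_mul_hallG_right (R : C) (L : IsoClass C) (F : IsoClass C → ℂ) (s : Finset (IsoClass C))
    (hs : ∀ Q, F Q ≠ 0 → Q ∈ s) [DecidableEq (IsoClass C)] :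
    ∑ Q ∈ s, F Q * hallG R L Q =
      ∑ X : Subobject R, if isoClass (cokernel X.arrow) = L then F (isoClass (X : C)) else 0 := by
  classical
  simp only [hallG_eq_sum, Finset.mul_sum]
  rw [Finset.sum_comm]
  refine Finset.sum_congr rfl fun X _ => ?_
  simp only [and_comm, ite_and, mul_ite, mul_one, mul_zero, Finset.sum_ite_eq]
  split_ifs with h1 h2 <;> first | rfl | skip
  exact (not_not.1 fun h => h1 (hs _ h)).symm

/-- Both sides count the flags with prescribed classes of subquotients. -/
lemma sum_hallG_mul_hallG (R : C) (L M N : IsoClass C) (s t : Finset (IsoClass C))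
    (hs : ∀ Q, hallG Q.rep L M ≠ 0 → Q ∈ s) (ht : ∀ Q, hallG Q.rep M N ≠ 0 → Q ∈ t) :
    ∑ Q ∈ s, (hallG Q.rep L M : ℂ) * hallG R Q N = ∑ Q ∈ t, (hallG Q.rep M N : ℂ) * hallG R L Q := by
  classical
  rw [sum_mul_hallG_left R N (fun Q => (hallG Q.rep L M : ℂ)) s fun Q h => hs Q (by exact_mod_cast h),
    sum_mul_hallG_right R L (fun Q => (hallG Q.rep M N : ℂ)) t fun Q h => ht Q (by exact_mod_cast h)]
  have h := sum_flags R fun A B D => if A = L ∧ B = M ∧ D = N then (1 : ℂ) else 0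
  convert h using 2 with X _ X _
  · rw [hallG_congr (nonempty_rep_iso (cokernel X.arrow)).some, hallG_eq_sum]
    split_ifs with h1 <;> simp [h1]
  · rw [hallG_congr (nonempty_rep_iso (X : C)).some, hallG_eq_sum]
    split_ifs with h1 <;> simp [h1]

/-- The coefficient of [R] counts flags on either side. A nonzero Hall number forces the
intermediate class Q to equal L + M, respectively M + N, in K(C), so bimultiplicativity makes the
scalars agree. -/
theorem mul_assoc_hall (x y z : ExtHall C) :
    mul χ (mul χ x y) z = mul χ x (mul χ y z) := by
  classical
  induction x using induction_elt with
  | h0 => simp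
  | hadd x x' hx hx' => simp [hx, hx']
  | hsmul c x hx => simp [hx]
  | helt L α =>
  induction y using induction_elt with
  | h0 => simp
  | hadd x x' hx hx' => simp [hx, hx']
  | hsmul c x hx => simp [hx]
  | helt M β =>
  induction z using induction_elt with
  | h0 => simp
  | hadd x x' hx hx' => simp [hx, hx']
  | hsmul c x hx => simp [hx]
  | helt N γ =>
  generalize isoClass L = L
  generalize isoClass M = M
  generalize isoClass N = N
  have mem (M N R : IsoClass C) (h : hallG R.rep M N ≠ 0) : R ∈ extensions.{w} M N := by
    rwa [extensions, Set.Finite.mem_toFinset]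
  set s := extensions.{w} L M
  set t := extensions.{w} M N
  -- One finite set of classes containing all that occur in either bracketing, so that coefficients
  -- can be compared termwise.
  let r := s.biUnion (fun Q => extensions.{w} Q N) ∪ t.biUnion (fun Q => extensions.{w} L Q)
  rw [mul_elt_sum χ L M α β s (mem L M), mul_elt_sum χ M N β γ t (mem M N)]
  simp only [map_sum, map_smul, LinearMap.smul_apply, LinearMap.sum_apply]
  have h1 : ∀ Q ∈ s, (hallG Q.rep L M : ℂ) • mul χ (elt Q (α + β)) (elt N γ) =
      (χ.symm (α + β) N.k0 * (χ.pair L.k0 N.k0 * χ.pair M.k0 N.k0)) •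
        ∑ R ∈ r, ((hallG Q.rep L M : ℂ) * hallG R.rep Q N) • elt R (α + β + γ) := by
    intro Q hQ
    rw [mul_elt_sum χ Q N _ γ r fun R hR => Finset.mem_union_left _
      (Finset.mem_biUnion.2 ⟨Q, hQ, mem _ _ _ hR⟩)]
    by_cases h : hallG Q.rep L M = 0
    · simp [h]
    · rw [← EulerRoot.pair_add_left, ← k0_eq_of_hallG_ne_zero h, smul_comm, Finset.smul_sum]
      simp only [smul_smul]
      rfl
  have h2 : ∀ Q ∈ t, (hallG Q.rep M N : ℂ) • mul χ (elt L α) (elt Q (β + γ)) =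
      (χ.symm α M.k0 * χ.symm α N.k0 * (χ.pair L.k0 M.k0 * χ.pair L.k0 N.k0)) •
        ∑ R ∈ r, ((hallG Q.rep M N : ℂ) * hallG R.rep L Q) • elt R (α + β + γ) := by
    intro Q hQ
    rw [mul_elt_sum χ L Q α _ r fun R hR => Finset.mem_union_right _
      (Finset.mem_biUnion.2 ⟨Q, hQ, mem _ _ _ hR⟩)]
    by_cases h : hallG Q.rep M N = 0
    · simp [h]
    · rw [← EulerRoot.pair_add_right, ← EulerRoot.symm_add_right, ← k0_eq_of_hallG_ne_zero h,
        smul_comm, Finset.smul_sum]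
      simp only [smul_smul, add_assoc]
      rfl
  rw [Finset.sum_congr rfl h1, Finset.sum_congr rfl h2, ← Finset.smul_sum, ← Finset.smul_sum,
    Finset.sum_comm, Finset.sum_comm (s := t), smul_smul, smul_smul]
  simp only [← Finset.sum_smul]
  congr 1
  · rw [EulerRoot.symm_add_left]; ring
  · exact Finset.sum_congr rfl fun R _ => by
      rw [sum_hallG_mul_hallG R.rep L M N s t (mem L M) (mem M N)]

/-- Both sides are the same sum over flags: the automorphism number of the intermediate object R/X
or Y cancels. -/
theorem comul_coassoc :
    (TensorProduct.assoc ℂ (ExtHall C) (ExtHall C) (ExtHall C)).toLinearMap ∘ₗ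
      (comul χ).rTensor (ExtHall C) ∘ₗ comul χ = (comul χ).lTensor (ExtHall C) ∘ₗ comul χ := by
  refine hom_ext_elt fun R α => ?_
  simp only [LinearMap.comp_apply, LinearEquiv.coe_coe, comul_elt, map_sum, map_smul,
    LinearMap.rTensor_tmul, LinearMap.lTensor_tmul, TensorProduct.sum_tmul, TensorProduct.tmul_sum,
    ← TensorProduct.smul_tmul', TensorProduct.tmul_smul, TensorProduct.assoc_tmul, Finset.smul_sum,
    smul_smul]
  have h := sum_flags R fun A B D => (χ.pair A.k0 D.k0 * χ.pair B.k0 D.k0 * χ.pair A.k0 B.k0 *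
    ((A.a : ℂ) * B.a * D.a / (isoClass R).a)) •
      (elt A (B.k0 + D.k0 + α) ⊗ₜ[ℂ] (elt B (D.k0 + α) ⊗ₜ[ℂ] elt D α))
  convert h using 4 with X _ Y _ Y _ X _
  · have := a_ne_zero (isoClass (cokernel X.arrow))
    rw [comulCoeff, comulCoeff, k0_isoClass (cokernel X.arrow), k0Class_subobject Y,
      EulerRoot.pair_add_left]
    field_simp
  · rw [add_assoc]
  · have := a_ne_zero (isoClass (Y : C))
    rw [comulCoeff, comulCoeff, k0_isoClass (Y : C), k0Class_subobject X,
      EulerRoot.pair_add_right]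
    field_simp
  · rw [k0_isoClass (Y : C), k0Class_subobject X, add_comm (IsoClass.k0 _) (IsoClass.k0 _)]

end Formulas

/-! ### The bialgebra axioms -/

section Bialgebra

variable [∀ M N : C, Finite (M ⟶ N)] [∀ M : C, Fintype (Subobject M)]
  [HasExt.{w} C] [∀ M N : C, Finite (Ext.{w} M N 1)] (χ : EulerRoot.{w} C)

lemma a_zero : (isoClass (0 : C)).a = 1 := by
  rw [a_isoClass, Nat.card_eq_one_iff_unique]
  exact ⟨⟨fun f g => Iso.ext ((isZero_zero C).eq_of_src _ _)⟩, ⟨Iso.refl _⟩⟩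

lemma comulCoeff_zero_left (R : IsoClass C) : comulCoeff χ R (isoClass (0 : C)) R = 1 := by
  have := a_ne_zero R
  rw [comulCoeff, k0_isoClass_zero, EulerRoot.pair_zero_left, a_zero]
  field_simp
  simp

lemma comulCoeff_zero_right (R : IsoClass C) : comulCoeff χ R R (isoClass (0 : C)) = 1 := by
  have := a_ne_zero R
  rw [comulCoeff, k0_isoClass_zero, EulerRoot.pair_zero_right, a_zero]
  field_simp
  simp

/-- Only the subobject ⊤ has quotient 0. -/
theorem rTensor_counit_comul :
    (counit C).rTensor (ExtHall C) ∘ₗ comul χ = TensorProduct.mk ℂ ℂ (ExtHall C) 1 := by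
  classical
  refine hom_ext_elt fun R α => ?_
  simp only [LinearMap.comp_apply, comul_elt, map_sum, map_smul, LinearMap.rTensor_tmul,
    counit_elt]
  rw [Finset.sum_eq_single (⊤ : Subobject R)]
  · rw [isoClass_cokernel_top, isoClass_top, if_pos rfl, comulCoeff_zero_left, one_smul]
    rfl
  · intro X _ hX
    rw [if_neg fun h => hX ((isoClass_cokernel_eq_zero_iff X).1 h), TensorProduct.zero_tmul,
      smul_zero]
  · simp

theorem lTensor_counit_comul :
    (counit C).lTensor (ExtHall C) ∘ₗ comul χ = (TensorProduct.mk ℂ (ExtHall C) ℂ).flip 1 := by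
  classical
  refine hom_ext_elt fun R α => ?_
  simp only [LinearMap.comp_apply, comul_elt, map_sum, map_smul, LinearMap.lTensor_tmul,
    counit_elt]
  rw [Finset.sum_eq_single (⊥ : Subobject R)]
  · rw [isoClass_cokernel_bot, isoClass_bot, if_pos rfl, comulCoeff_zero_right, one_smul,
      k0_isoClass_zero, zero_add]
    rfl
  · intro X _ hX
    rw [if_neg fun h => hX ((isoClass_subobject_eq_zero_iff X).1 h), TensorProduct.tmul_zero,
      smul_zero]
  · simp

lemma subobject_eq_top_of_isZero {M : C} (h : IsZero M) (X : Subobject M) : X = ⊤ := by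
  have : IsIso X.arrow := ⟨0, (h.of_mono X.arrow).eq_of_src _ _, h.eq_of_src _ _⟩
  exact Subobject.eq_top_of_isIso_arrow X

lemma comul_kElt (α : K0 C) : comul χ (kElt α) = kElt α ⊗ₜ[ℂ] kElt α := by
  rw [kElt, comul_elt, Finset.sum_eq_single (⊤ : Subobject (0 : C))]
  · rw [isoClass_cokernel_top, isoClass_top, comulCoeff_zero_left, one_smul, k0_isoClass_zero,
      zero_add]
  · exact fun X _ hX => (hX (subobject_eq_top_of_isZero (isZero_zero C) X)).elim
  · simp

/-- If M ≠ 0, the zero object does not occur as an extension of M by N, since all its quotients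
vanish. -/
theorem counit_mul (x y : ExtHall C) : counit C (mul χ x y) = counit C x * counit C y := by
  classical
  induction x using induction_elt with
  | h0 => simp
  | hadd x x' hx hx' => simp [hx, hx', add_mul]
  | hsmul c x hx => simp [hx, mul_assoc]
  | helt M α =>
  induction y using induction_elt with
  | h0 => simp
  | hadd x x' hx hx' => simp [hx, hx', mul_add]
  | hsmul c x hx => simp [hx, mul_left_comm]
  | helt N β =>
  by_cases hM : isoClass M = isoClass (0 : C)
  · rw [hM]
    have := kElt_mul_elt χ (isoClass N) α β
    rw [kElt] at this
    rw [this, map_smul, counit_elt, counit_elt, counit_elt, if_pos rfl, one_mul]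
    split_ifs with h
    · simp [h, k0_isoClass_zero]
    · simp
  · rw [mul_elt_sum χ _ _ _ _ (extensions.{w} (isoClass M) (isoClass N)), counit_elt _ α, if_neg hM,
      zero_mul, map_smul, map_sum, Finset.sum_eq_zero, smul_zero]
    · intro R _
      rw [map_smul, counit_elt]
      split_ifs with h
      · suffices hallG R.rep (isoClass M) (isoClass N) = 0 by simp [this]
        by_contra h'
        obtain ⟨⟨X, hX, -⟩⟩ := (Nat.card_ne_zero.1 h').1
        rw [subobject_eq_top_of_isZero (isoClass_eq_zero_iff.1 ((isoClass_rep R).trans h)) X,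
          isoClass_cokernel_top] at hX
        exact hM hX.symm
      · simp
    · intro R hR
      rwa [extensions, Set.Finite.mem_toFinset]

lemma comul_elt_finset (R : IsoClass C) (α : K0 C) (s : Finset (IsoClass C × IsoClass C))
    (hs : ∀ MN : IsoClass C × IsoClass C, hallG R.rep MN.1 MN.2 ≠ 0 → MN ∈ s) :
    comul χ (elt R α) = ∑ MN ∈ s, ((hallG R.rep MN.1 MN.2 : ℂ) * comulCoeff χ R MN.1 MN.2) •
      (elt MN.1 (MN.2.k0 + α) ⊗ₜ[ℂ] elt MN.2 α) := by
  have h := comul_elt χ R.rep α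
  rw [← finsum_hallG R.rep (fun MN => comulCoeff χ (isoClass R.rep) MN.1 MN.2 •
      (elt MN.1 (MN.2.k0 + α) ⊗ₜ[ℂ] elt MN.2 α)), isoClass_rep,
      finsum_eq_sum_of_support_subset (s := s)] at h
  · simpa only [smul_smul] using h
  · intro MN h
    refine hs MN fun h' => h ?_
    dsimp only
    rw [h', Nat.cast_zero, zero_smul]

/-- Green's formula in terms of Hall numbers. -/
lemma green_coeff (hher : IsHereditary.{w} C) (M N : C) (M' N' : IsoClass C)
    (s : Finset (IsoClass C)) (hs : ∀ R, hallG R.rep (isoClass M) (isoClass N) ≠ 0 → R ∈ s) :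
    ∑ R ∈ s, χ.pair (k0Class M) (k0Class N) * (hallG R.rep (isoClass M) (isoClass N) : ℂ) *
        (hallG R.rep M' N' * comulCoeff χ R M' N') =
      ∑ BD : Subobject M × Subobject N,
        comulCoeff χ (isoClass M) (isoClass (cokernel BD.1.arrow)) (isoClass (BD.1 : C)) *
        comulCoeff χ (isoClass N) (isoClass (cokernel BD.2.arrow)) (isoClass (BD.2 : C)) *
        (χ.symm (isoClass (BD.1 : C)).k0 (isoClass (cokernel BD.2.arrow)).k0 *
          χ.pair (isoClass (cokernel BD.1.arrow)).k0 (isoClass (cokernel BD.2.arrow)).k0 *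
          χ.pair (isoClass (BD.1 : C)).k0 (isoClass (BD.2 : C)).k0) *
        (hallG M'.rep (isoClass (cokernel BD.1.arrow)) (isoClass (cokernel BD.2.arrow)) *
          hallG N'.rep (isoClass (BD.1 : C)) (isoClass (BD.2 : C))) := by
  have g := green.{w} hher M N M'.rep N'.rep
  simp only [card_SES, isoClass_rep] at g
  rw [finsum_eq_sum_of_support_subset (s := s)] at g
  · have hM := a_ne_zero (isoClass M)
    have hN := a_ne_zero (isoClass N)
    have e (R : IsoClass C) : χ.pair (k0Class M) (k0Class N) *
        (hallG R.rep (isoClass M) (isoClass N) : ℂ) * (hallG R.rep M' N' * comulCoeff χ R M' N') =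
        χ.pair (k0Class M) (k0Class N) * χ.pair M'.k0 N'.k0 / ((isoClass M).a * (isoClass N).a) *
        (((hallG R.rep (isoClass M) (isoClass N) * ((isoClass M).a * (isoClass N).a) : ℕ) : ℂ) *
          ((hallG R.rep M' N' * (M'.a * N'.a) : ℕ) : ℂ) / R.a) := by
      rw [comulCoeff]
      push_cast
      field_simp
    rw [Finset.sum_congr rfl fun R _ => e R, ← Finset.mul_sum, g, Finset.mul_sum]
    refine Finset.sum_congr rfl fun BD _ => ?_
    obtain ⟨B, D⟩ := BD
    dsimp only
    by_cases h1 : hallG M'.rep (isoClass (cokernel B.arrow)) (isoClass (cokernel D.arrow)) = 0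
    · simp [h1]
    by_cases h2 : hallG N'.rep (isoClass (B : C)) (isoClass (D : C)) = 0
    · simp [h2]
    have k1 : M'.k0 = _ := k0_eq_of_hallG_ne_zero h1
    have k2 : N'.k0 = _ := k0_eq_of_hallG_ne_zero h2
    have q := χ.pair_sq (cokernel B.arrow) (D : C)
    have q0 := χ.pair_ne_zero (k0Class (cokernel B.arrow)) (k0Class (D : C))
    have q1 := card_hom_ne_zero (cokernel B.arrow) (D : C)
    have q2 := card_ext_ne_zero.{w} (cokernel B.arrow) (D : C)
    rw [← k0_isoClass, ← k0_isoClass] at q q0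
    -- With A = M/B and E = N/D, expanding ⟨M, N⟩⟨M', N'⟩ for M' = A + E, N' = B + D produces ⟨A,
    -- D⟩², which Green's factor cancels, and ⟨B, E⟩⟨E, B⟩ = (B, E), the twist from moving k_B past
    -- E.
    have q' : (Nat.card (Ext.{w} (cokernel B.arrow) (D : C) 1) : ℂ) /
        Nat.card (cokernel B.arrow ⟶ (D : C)) =
        1 / χ.pair (isoClass (cokernel B.arrow)).k0 (isoClass (D : C)).k0 ^ 2 := by
      rw [q, one_div_div]
    rw [q', k1, k2, k0Class_subobject B, k0Class_subobject D, comulCoeff, comulCoeff]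
    simp only [EulerRoot.pair_add_left, EulerRoot.pair_add_right, EulerRoot.symm]
    push_cast
    field_simp
  · intro R hR
    refine hs R fun h' => hR ?_
    dsimp only
    rw [h', zero_mul, Nat.cast_zero, zero_mul, zero_div]

/-- One summand of Δ(x)Δ(y). The symmetric form (B, E) arises because the first tensor factor
carries k_B, which is moved past [E]. -/
lemma tmul_mul_tmul_elt (A B E D : IsoClass C) (α β : K0 C) (t : Finset (IsoClass C × IsoClass C))
    (ht : extensions.{w} A E ×ˢ extensions.{w} B D ⊆ t) :
    mul χ (elt A (B.k0 + α)) (elt E (D.k0 + β)) ⊗ₜ[ℂ] mul χ (elt B α) (elt D β) =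
      (χ.symm α E.k0 * χ.symm α D.k0) • ∑ MN ∈ t,
        ((χ.symm B.k0 E.k0 * χ.pair A.k0 E.k0 * χ.pair B.k0 D.k0) *
          ((hallG MN.1.rep A E : ℂ) * hallG MN.2.rep B D)) •
        (elt MN.1 (MN.2.k0 + (α + β)) ⊗ₜ[ℂ] elt MN.2 (α + β)) := by
  have mem (M N R : IsoClass C) (h : hallG R.rep M N ≠ 0) : R ∈ extensions.{w} M N := by
    rwa [extensions, Set.Finite.mem_toFinset]
  rw [mul_elt_sum χ A E _ _ _ (mem A E), mul_elt_sum χ B D _ _ _ (mem B D),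
    ← Finset.sum_subset ht, Finset.sum_product, TensorProduct.smul_tmul_smul,
    TensorProduct.sum_tmul, Finset.smul_sum, Finset.smul_sum]
  · refine Finset.sum_congr rfl fun M' _ => ?_
    rw [TensorProduct.tmul_sum, Finset.smul_sum, Finset.smul_sum]
    refine Finset.sum_congr rfl fun N' _ => ?_
    by_cases h : hallG N'.rep B D = 0
    · simp [h]
    have k : N'.k0 = _ := k0_eq_of_hallG_ne_zero h
    rw [TensorProduct.smul_tmul_smul, smul_smul, smul_smul]
    dsimp only
    congr 1
    · rw [EulerRoot.symm_add_left]; ring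
    · rw [k]
      congr 2
      abel
  · rintro ⟨M', N'⟩ _ h
    have : hallG M'.rep A E = 0 ∨ hallG N'.rep B D = 0 := by
      by_contra! h'
      exact h (Finset.mem_product.2 ⟨mem _ _ _ h'.1, mem _ _ _ h'.2⟩)
    rcases this with h | h <;> simp [h]

/-- Comparing coefficients over a common finite set `t` of pairs leaves exactly `green_coeff`; the
scalar (α, N) splits off from both sides. -/
theorem comul_mul (hher : IsHereditary.{w} C) (x y : ExtHall C) :
    comul χ (mul χ x y) = TensorProduct.map₂ (mul χ) (mul χ) (comul χ x) (comul χ y) := by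
  classical
  induction x using induction_elt with
  | h0 => simp
  | hadd x x' hx hx' => simp [hx, hx']
  | hsmul c x hx => simp [hx]
  | helt M α =>
  induction y using induction_elt with
  | h0 => simp
  | hadd x x' hx hx' => simp [hx, hx']
  | hsmul c x hx => simp [hx]
  | helt N β =>
  have mem (M N R : IsoClass C) (h : hallG R.rep M N ≠ 0) : R ∈ extensions.{w} M N := by
    rwa [extensions, Set.Finite.mem_toFinset]
  set s := extensions.{w} (isoClass M) (isoClass N) with hs
  let t : Finset (IsoClass C × IsoClass C) :=
    s.biUnion (fun R => (finite_setOf_hallG_ne_zero R.rep).toFinset) ∪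
    Finset.univ.biUnion (fun BD : Subobject M × Subobject N =>
      extensions.{w} (isoClass (cokernel BD.1.arrow)) (isoClass (cokernel BD.2.arrow)) ×ˢ
      extensions.{w} (isoClass (BD.1 : C)) (isoClass (BD.2 : C)))
  have hl : comul χ (mul χ (elt (isoClass M) α) (elt (isoClass N) β)) =
      χ.symm α (isoClass N).k0 • ∑ MN ∈ t,
        (∑ R ∈ s, χ.pair (k0Class M) (k0Class N) * (hallG R.rep (isoClass M) (isoClass N) : ℂ) *
          (hallG R.rep MN.1 MN.2 * comulCoeff χ R MN.1 MN.2)) •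
        (elt MN.1 (MN.2.k0 + (α + β)) ⊗ₜ[ℂ] elt MN.2 (α + β)) := by
    rw [mul_elt_sum χ _ _ _ _ s (mem _ _), mul_smul, map_smul, map_smul, map_sum]
    congr 1
    simp only [Finset.sum_smul]
    rw [Finset.sum_comm, Finset.smul_sum]
    refine Finset.sum_congr rfl fun R hR => ?_
    rw [map_smul, comul_elt_finset χ R _ t, Finset.smul_sum, Finset.smul_sum]
    · simp only [smul_smul, k0_isoClass, mul_assoc]
    · exact fun MN h => Finset.mem_union_left _ (Finset.mem_biUnion.2
        ⟨R, hR, (Set.Finite.mem_toFinset _).2 h⟩)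
  have hr : TensorProduct.map₂ (mul χ) (mul χ) (comul χ (elt (isoClass M) α))
      (comul χ (elt (isoClass N) β)) =
      χ.symm α (isoClass N).k0 • ∑ MN ∈ t, (∑ BD : Subobject M × Subobject N,
        comulCoeff χ (isoClass M) (isoClass (cokernel BD.1.arrow)) (isoClass (BD.1 : C)) *
        comulCoeff χ (isoClass N) (isoClass (cokernel BD.2.arrow)) (isoClass (BD.2 : C)) *
        (χ.symm (isoClass (BD.1 : C)).k0 (isoClass (cokernel BD.2.arrow)).k0 *
          χ.pair (isoClass (cokernel BD.1.arrow)).k0 (isoClass (cokernel BD.2.arrow)).k0 *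
          χ.pair (isoClass (BD.1 : C)).k0 (isoClass (BD.2 : C)).k0) *
        (hallG MN.1.rep (isoClass (cokernel BD.1.arrow)) (isoClass (cokernel BD.2.arrow)) *
          hallG MN.2.rep (isoClass (BD.1 : C)) (isoClass (BD.2 : C)))) •
        (elt MN.1 (MN.2.k0 + (α + β)) ⊗ₜ[ℂ] elt MN.2 (α + β)) := by
    simp only [comul_elt, map_sum, map_smul, LinearMap.sum_apply, LinearMap.smul_apply,
      TensorProduct.map₂_apply_tmul, TensorProduct.map_tmul, Finset.sum_smul]
    rw [Finset.sum_comm (s := t), Fintype.sum_prod_type_right, Finset.smul_sum]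
    refine Finset.sum_congr rfl fun D _ => ?_
    rw [Finset.smul_sum, Finset.smul_sum]
    refine Finset.sum_congr rfl fun B _ => ?_
    rw [tmul_mul_tmul_elt χ _ _ _ _ α β t]
    · rw [smul_smul, smul_smul, k0_isoClass N, k0Class_subobject D, EulerRoot.symm_add_right,
        Finset.smul_sum, Finset.smul_sum]
      refine Finset.sum_congr rfl fun MN _ => ?_
      rw [smul_smul, smul_smul]
      congr 1
      ring
    · exact fun MN h => Finset.mem_union_right _ (Finset.mem_biUnion.2
        ⟨(B, D), Finset.mem_univ _, h⟩)
  rw [hl, hr]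
  congr 1
  refine Finset.sum_congr rfl fun MN _ => ?_
  rw [green_coeff χ hher M N MN.1 MN.2 s (mem _ _)]

end Bialgebra

/-! ### Strict filtrations -/

namespace StrictFiltration

/-- Comparison at natural-number indices avoids a heterogeneous equality between step functions of
different lengths. -/
lemma ext_step {M : C} {F G : StrictFiltration M} (hr : F.r = G.r)
    (h : ∀ (i : ℕ) (hF : i < F.r + 1) (hG : i < G.r + 1), F.step ⟨i, hF⟩ = G.step ⟨i, hG⟩) :
    F = G := by
  obtain ⟨r, s, _, _, _⟩ := F
  obtain ⟨r', s', _, _, _⟩ := G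
  obtain rfl : r = r' := hr
  obtain rfl : s = s' := funext fun i => h i i.2 i.2
  rfl

theorem finite (M : C) [Finite (Subobject M)] : Finite (StrictFiltration M) := by
  have hr (F : StrictFiltration M) : F.r < Nat.card (Subobject M) := by
    have := Nat.card_le_card_of_injective F.step F.strictAnti.injective
    rw [Nat.card_fin] at this
    exact this
  refine Finite.of_injective (fun F : StrictFiltration M =>
    (⟨⟨F.r, hr F⟩, F.step⟩ : Σ r : Fin (Nat.card (Subobject M)), (Fin (r + 1) → Subobject M))) ?_
  rintro ⟨r, s, _, _, _⟩ ⟨r', s', _, _, _⟩ h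
  simp only [Sigma.mk.injEq, Fin.mk.injEq] at h
  obtain ⟨rfl, h⟩ := h
  obtain rfl := eq_of_heq h
  rfl

section Cons

variable {M : C} (X : Subobject M) (hX : X ≠ ⊤) (G : StrictFiltration (X : C))

/-- The filtration of `M` whose first proper step is `X`. -/
def cons : StrictFiltration M where
  r := G.r + 1
  step := Fin.cons ⊤ fun i => (Subobject.map X.arrow).obj (G.step i)
  strictAnti := by
    refine Fin.strictAnti_iff_succ_lt.2 fun i => ?_
    cases i using Fin.cases with
    | zero =>
      rw [Fin.cons_succ, Fin.castSucc_zero, Fin.cons_zero, G.step_zero, Subobject.map_top,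
        Subobject.mk_arrow]
      exact lt_top_iff_ne_top.2 hX
    | succ i =>
      rw [Fin.cons_succ, ← Fin.succ_castSucc, Fin.cons_succ]
      have h := G.strictAnti i.castSucc_lt_succ
      exact lt_of_le_not_ge ((map_le_map_iff _).2 h.le) fun h' => h.not_ge ((map_le_map_iff _).1 h')
  step_zero := rfl
  step_last := by
    rw [← Fin.succ_last, Fin.cons_succ, G.step_last, Subobject.map_bot]

lemma cons_step_one : (cons X hX G).step 1 = X := by
  change (Fin.cons ⊤ (fun i => (Subobject.map X.arrow).obj (G.step i)) : Fin (G.r + 2) → _)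
    (Fin.succ 0) = X
  rw [Fin.cons_succ, G.step_zero, Subobject.map_top, Subobject.mk_arrow]

lemma subquotient_cons_zero :
    (cons X hX G).subquotient (0 : Fin (G.r + 1)) = isoClass (cokernel X.arrow) := by
  exact (isoClass_cokernel_ofLE_congr _ (le_top (a := X)) (cons_step_one X hX G) rfl).trans
    (isoClass_cokernel_ofLE_top X _)

lemma subquotient_cons_succ (i : Fin G.r) :
    (cons X hX G).subquotient (Fin.succ i : Fin (G.r + 1)) = G.subquotient i :=
  isoClass_cokernel_map_ofLE X.arrow _ _

end Cons

/-- A filtration of M ≠ 0 has at least one step, as r = 0 would give ⊤ = ⊥; it amounts to X = L₂ and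
a filtration of X, possibly the empty one for X = 0. -/
lemma cons_bijective {M : C} (hM : ¬ IsZero M) : Function.Bijective
    (fun p : Σ X : { X : Subobject M // X ≠ ⊤ }, StrictFiltration (X.1 : C) =>
      cons p.1.1 p.1.2 p.2) := by
  constructor
  · rintro ⟨⟨X, hX⟩, G⟩ ⟨⟨X', hX'⟩, G'⟩ h
    dsimp only at h
    obtain rfl : X = X' := by
      rw [← cons_step_one X hX G, ← cons_step_one X' hX' G', h]
    have hr : G.r = G'.r := Nat.succ_injective (congrArg StrictFiltration.r h)
    have hs (i : ℕ) (hG : i < G.r + 1) (hG' : i < G'.r + 1) :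
        (cons X hX G).step ⟨i + 1, Nat.succ_lt_succ hG⟩ =
          (cons X hX' G').step ⟨i + 1, Nat.succ_lt_succ hG'⟩ := by
      have (F F' : StrictFiltration M) (hF : F = F') (i : ℕ) (h : i < F.r + 1) (h' : i < F'.r + 1) :
          F.step ⟨i, h⟩ = F'.step ⟨i, h'⟩ := by
        subst hF
        rfl
      exact this _ _ h _ _ _
    obtain rfl : G = G' := ext_step hr fun i hG hG' =>
      Subobject.map_obj_injective X.arrow (hs i hG hG')
    rfl
  · rintro ⟨r, step, anti, h0, hl⟩
    cases r with
    | zero =>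
      exfalso
      have : (⊤ : Subobject M) = ⊥ := h0.symm.trans hl
      have h1 := isoClass_top (M := M)
      rw [this, isoClass_bot] at h1
      exact hM (isoClass_eq_zero_iff.1 h1.symm)
    | succ n =>
      have hX : step (Fin.succ 0) < ⊤ := h0 ▸ anti (Fin.succ_pos 0)
      have hex (i : Fin (n + 1)) : ∃ A : Subobject (step (Fin.succ 0) : C),
          (Subobject.map (step (Fin.succ 0)).arrow).obj A = step i.succ := by
        refine exists_map_eq _ ?_
        rw [Subobject.mk_arrow]
        exact anti.antitone (Fin.succ_le_succ_iff.2 (Fin.zero_le i))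
      choose A hA using hex
      have hlt {i j : Fin (n + 1)} (h : i < j) : A j < A i := by
        have := anti (Fin.succ_lt_succ_iff.2 h)
        rw [← hA i, ← hA j] at this
        exact lt_of_le_not_ge ((map_le_map_iff _).1 this.le)
          fun h' => this.not_ge ((map_le_map_iff _).2 h')
      refine ⟨⟨⟨step (Fin.succ 0), hX.ne⟩, ⟨n, A, fun i j h => hlt h, ?_, ?_⟩⟩, ?_⟩
      · apply Subobject.map_obj_injective (step (Fin.succ 0)).arrow
        rw [hA, Subobject.map_top, Subobject.mk_arrow]
      · apply Subobject.map_obj_injective (step (Fin.succ 0)).arrow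
        rw [hA, Subobject.map_bot, Fin.succ_last, hl]
      · refine ext_step rfl fun i hF hG => ?_
        cases i with
        | zero => exact h0.symm
        | succ i => exact hA ⟨i, Nat.succ_lt_succ_iff.1 hG⟩

section Sum

variable [∀ M N : C, Finite (M ⟶ N)] [∀ M : C, Fintype (Subobject M)]
  [HasExt.{w} C] [∀ M N : C, Finite (Ext.{w} M N 1)] (χ : EulerRoot.{w} C)

lemma product_cons {M : C} (X : Subobject M) (hX : X ≠ ⊤) (G : StrictFiltration (X : C)) :
    (cons X hX G).product χ = mul χ (elt (isoClass (cokernel X.arrow)) 0) (G.product χ) := by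
  change ((List.ofFn fun i : Fin (G.r + 1) => elt ((cons X hX G).subquotient (i : Fin (cons X hX G).r)) 0).foldr
    (fun x y => mul χ x y) (one C)) = _
  rw [List.ofFn_succ, List.foldr_cons]
  erw [subquotient_cons_zero]
  simp only [subquotient_cons_succ]
  rfl

/-- The sign is the extra step; the a_X in the coproduct coefficient cancels the denominator of the
coefficient of G. This is how the coproduct enters S. -/
lemma coeff_cons {M : C} (X : Subobject M) (hX : X ≠ ⊤) (G : StrictFiltration (X : C)) :
    (cons X hX G).coeff χ =
      -comulCoeff χ (isoClass M) (isoClass (cokernel X.arrow)) (isoClass (X : C)) * G.coeff χ := by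
  have hX' := a_ne_zero (isoClass (X : C))
  have e (i : Fin G.r) : k0Class ((cons X hX G).step (Fin.succ (Fin.succ i : Fin (G.r + 1))) : C) =
      k0Class (G.step i.succ : C) :=
    k0Class_eq_of_iso (mapUnderlyingIso X.arrow (G.step i.succ)).symm
  have h₁ : ∏ i : Fin (cons X hX G).r, χ.pair ((cons X hX G).subquotient i).k0
        (k0Class ((cons X hX G).step i.succ : C)) =
      χ.pair (isoClass (cokernel X.arrow)).k0 (k0Class (X : C)) *
        ∏ i : Fin G.r, χ.pair (G.subquotient i).k0 (k0Class (G.step i.succ : C)) := by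
    refine (Fin.prod_univ_succ (n := G.r) _).trans
      (congrArg₂ _ ?_ (Finset.prod_congr rfl fun i _ => ?_))
    · exact congrArg₂ (fun (A : IsoClass C) (Y : Subobject M) => χ.pair A.k0 (k0Class (Y : C)))
        (subquotient_cons_zero X hX G) (cons_step_one X hX G)
    · exact congrArg₂ (fun (A : IsoClass C) β => χ.pair A.k0 β)
        (subquotient_cons_succ X hX G i) (e i)
  have h₂ : ∏ i : Fin (cons X hX G).r, (((cons X hX G).subquotient i).a : ℂ) =
      (isoClass (cokernel X.arrow)).a * ∏ i : Fin G.r, ((G.subquotient i).a : ℂ) := by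
    refine (Fin.prod_univ_succ (n := G.r) _).trans
      (congrArg₂ _ ?_ (Finset.prod_congr rfl fun i _ => ?_))
    · exact congrArg (fun A : IsoClass C => (A.a : ℂ)) (subquotient_cons_zero X hX G)
    · exact congrArg (fun A : IsoClass C => (A.a : ℂ)) (subquotient_cons_succ X hX G i)
  have hr : (cons X hX G).r = G.r + 1 := rfl
  rw [coeff, h₁, h₂, hr, comulCoeff, coeff, ← a_isoClass, ← a_isoClass, k0_isoClass (X : C),
    pow_succ]
  field_simp

lemma sum_eq_of_isZero {M : C} (hM : IsZero M) :
    ∑ᶠ F : StrictFiltration M, F.coeff χ • F.product χ = one C := by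
  have htop (X : Subobject M) : X = ⊤ := subobject_eq_top_of_isZero hM X
  have hr (F : StrictFiltration M) : F.r = 0 := by
    by_contra h
    exact (F.strictAnti (Fin.pos_iff_ne_zero.2 fun h' => h (congrArg Fin.val h') :
      0 < Fin.last F.r)).ne ((htop _).trans (htop _).symm)
  let F : StrictFiltration M :=
    ⟨0, fun _ => ⊤, fun i j h => (h.ne (Subsingleton.elim (α := Fin 1) _ _)).elim, rfl, (htop _).symm⟩
  have ha : Nat.card (Aut M) = 1 := by
    rw [← a_isoClass, isoClass_eq_zero_iff.2 hM, a_zero]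
  rw [finsum_eq_single _ F]
  · simp [F, coeff, product, ha]
  · intro G hG
    exact (hG (ext_step (hr G) fun i _ _ => (htop _).trans (htop _).symm)).elim

/-- The recursion for S: the filtrations are grouped by their first proper step X. -/
lemma sum_eq {M : C} (hM : ¬ IsZero M) [DecidableEq (Subobject M)] :
    ∑ᶠ F : StrictFiltration M, F.coeff χ • F.product χ =
      ∑ X : Subobject M, if X = ⊤ then 0 else
        -(comulCoeff χ (isoClass M) (isoClass (cokernel X.arrow)) (isoClass (X : C)) •
          mul χ (elt (isoClass (cokernel X.arrow)) 0)
            (∑ᶠ F : StrictFiltration (X : C), F.coeff χ • F.product χ)) := by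
  have hfin (M : C) := finite M
  let _ (M : C) : Fintype (StrictFiltration M) := Fintype.ofFinite _
  simp only [finsum_eq_sum_of_fintype]
  rw [← (Equiv.ofBijective _ (cons_bijective hM)).sum_comp, Fintype.sum_sigma,
    ← Finset.sum_filter_of_ne (p := fun X : Subobject M => X ≠ ⊤),
    Finset.sum_subtype _ (p := fun X : Subobject M => X ≠ ⊤) (by simp)]
  · refine Finset.sum_congr rfl fun X _ => ?_
    rw [if_neg X.2, map_sum, Finset.smul_sum, ← Finset.sum_neg_distrib]
    refine Finset.sum_congr rfl fun G _ => ?_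
    rw [Equiv.ofBijective_apply, coeff_cons, product_cons, map_smul, smul_smul, neg_mul, neg_smul]
  · intro X _ h h'
    exact h (if_pos h')

end Sum

end StrictFiltration

/-! ### The antipode identities -/

section Antipode

variable [∀ M N : C, Finite (M ⟶ N)] [∀ M : C, Fintype (Subobject M)]
  [HasExt.{w} C] [∀ M N : C, Finite (Ext.{w} M N 1)] (χ : EulerRoot.{w} C)

lemma card_subobject_le {M N : C} (f : M ⟶ N) [Mono f] :
    Fintype.card (Subobject M) ≤ Fintype.card (Subobject N) :=
  Fintype.card_le_of_injective _ (Subobject.map_obj_injective f)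

/-- The number of subobjects serves as the measure for inductions on proper subobjects: ⊤ is not the
image of a subobject of X. -/
lemma card_subobject_lt {M : C} {X : Subobject M} (hX : X ≠ ⊤) :
    Fintype.card (Subobject (X : C)) < Fintype.card (Subobject M) := by
  refine Fintype.card_lt_of_injective_of_notMem _ (Subobject.map_obj_injective X.arrow) (b := ⊤) ?_
  rintro ⟨A, hA⟩
  refine hX (top_le_iff.1 ?_)
  rw [← hA]
  conv_rhs => rw [← Subobject.mk_arrow X, ← Subobject.map_top]
  exact (map_le_map_iff _).2 le_top

/-- `S([M]) = k_M⁻¹ · strictSum M` -/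
def strictSum (M : C) : ExtHall C := ∑ᶠ F : StrictFiltration M, F.coeff χ • F.product χ

/-- `antipode` uses chosen representatives, while the recursion produces actual subobjects.
Inductively the recursion involves only isomorphism classes, which spares transporting filtrations
along e. -/
lemma strictSum_congr {M N : C} (e : M ≅ N) : strictSum χ M = strictSum χ N := by
  classical
  suffices H : ∀ (n : ℕ) (M N : C), Fintype.card (Subobject M) < n → isoClass M = isoClass N →
      strictSum χ M = strictSum χ N from
    H _ M N (Nat.lt_succ_self _) (isoClass_eq_of_iso e)
  intro n
  induction n with
  | zero => exact fun M N h => absurd h (Nat.not_lt_zero _)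
  | succ n ih =>
    intro M N hn h
    obtain ⟨e⟩ := isoClass_eq_iff.1 h
    by_cases hM : IsZero M
    · rw [strictSum, strictSum, StrictFiltration.sum_eq_of_isZero χ hM,
        StrictFiltration.sum_eq_of_isZero χ (hM.of_iso e.symm)]
    have hN : ¬ IsZero N := fun h => hM (h.of_iso e)
    have key (M : C) (hn : Fintype.card (Subobject M) < n + 1) (hM : ¬ IsZero M) :
        strictSum χ M = ∑ X : Subobject M, if isoClass (cokernel X.arrow) = isoClass (0 : C) then 0
          else -(comulCoeff χ (isoClass M) (isoClass (cokernel X.arrow)) (isoClass (X : C)) •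
            mul χ (elt (isoClass (cokernel X.arrow)) 0) (strictSum χ (isoClass (X : C)).rep)) := by
      rw [strictSum, StrictFiltration.sum_eq χ hM]
      refine Finset.sum_congr rfl fun X _ => ?_
      simp only [isoClass_cokernel_eq_zero_iff]
      split_ifs with hX
      · rfl
      · rw [← ih (X : C) _ (Nat.lt_of_lt_of_le (card_subobject_lt hX) (Nat.lt_succ_iff.1 hn))
          (isoClass_rep _).symm, strictSum]
    rw [key M hn hM, key N (Nat.lt_of_le_of_lt (card_subobject_le e.inv) hn) hN, h]
    exact sum_subobject_congr e fun A B => if A = isoClass (0 : C) then 0 else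
      -(comulCoeff χ (isoClass N) A B • mul χ (elt A 0) (strictSum χ B.rep))

lemma antipode_elt (M : C) (α : K0 C) :
    antipode χ (elt (isoClass M) α) =
      mul χ (kElt (-α)) (mul χ (kElt (-(isoClass M).k0)) (strictSum χ M)) := by
  rw [antipode, elt, Finsupp.linearCombination_single, one_smul,
    ← strictSum_congr χ (nonempty_rep_iso M).some]
  rfl

lemma mulT_map_comul_elt (f g : ExtHall C →ₗ[ℂ] ExtHall C) (R : C) (α : K0 C) :
    mulT χ (TensorProduct.map f g (comul χ (elt (isoClass R) α))) = ∑ X : Subobject R,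
      comulCoeff χ (isoClass R) (isoClass (cokernel X.arrow)) (isoClass (X : C)) •
        mul χ (f (elt (isoClass (cokernel X.arrow)) ((isoClass (X : C)).k0 + α)))
          (g (elt (isoClass (X : C)) α)) := by
  simp only [comul_elt, map_sum, map_smul, TensorProduct.map_tmul, mulT, TensorProduct.lift.tmul]

/-- After the k-factors cancel, the left side is the sum over X of the coproduct coefficient times
[R/X] · `strictSum χ X`. For R ≠ 0 the term X = ⊤ is `strictSum χ R`, and the recursion makes it
minus the sum of all others. -/
theorem mulT_map_id_antipode_comul :
    mulT χ ∘ₗ TensorProduct.map LinearMap.id (antipode χ) ∘ₗ comul χ = unit C ∘ₗ counit C := by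
  classical
  refine hom_ext_elt fun R α => ?_
  simp only [LinearMap.comp_apply, mulT_map_comul_elt, LinearMap.id_apply, antipode_elt]
  -- With β the class of X, this is where the factors k_X k_α from the coproduct meet their inverses
  -- from S.
  have h (A : IsoClass C) (β : K0 C) (x : ExtHall C) :
      mul χ (elt A (β + α)) (mul χ (kElt (-α)) (mul χ (kElt (-β)) x)) = mul χ (elt A 0) x := by
    rw [← mul_assoc_hall, ← mul_assoc_hall, elt_mul_kElt, elt_mul_kElt]
    congr 3
    abel
  simp only [h, unit, LinearMap.toSpanSingleton_apply, counit_elt]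
  by_cases hR : IsZero R
  · rw [Finset.sum_eq_single (⊤ : Subobject R), isoClass_cokernel_top, isoClass_top,
      comulCoeff_zero_left, one_smul, if_pos (isoClass_eq_zero_iff.2 hR), one_smul,
      strictSum_congr χ (asIso (⊤ : Subobject R).arrow), strictSum,
      StrictFiltration.sum_eq_of_isZero χ hR]
    · exact mul_one_hall χ (one C)
    · exact fun X _ hX => (hX (subobject_eq_top_of_isZero hR X)).elim
    · simp
  · rw [if_neg (fun h => hR (isoClass_eq_zero_iff.1 h)), zero_smul,
      Fintype.sum_eq_add_sum_compl (⊤ : Subobject R), isoClass_cokernel_top, isoClass_top,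
      comulCoeff_zero_left, one_smul, strictSum_congr χ (asIso (⊤ : Subobject R).arrow)]
    have : mul χ (elt (isoClass (0 : C)) 0) (strictSum χ R) = strictSum χ R := one_mul_hall χ _
    rw [this]
    conv_lhs => arg 1; rw [strictSum, StrictFiltration.sum_eq χ hR,
      Fintype.sum_eq_add_sum_compl (⊤ : Subobject R), if_pos rfl, zero_add]
    rw [← Finset.sum_add_distrib]
    refine Finset.sum_eq_zero fun X hX => ?_
    rw [if_neg (by simpa using hX)]
    exact neg_add_cancel _

lemma eq_zero_of_kElt_mul_eq_zero {α : K0 C} {x : ExtHall C} (h : mul χ (kElt α) x = 0) :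
    x = 0 := by
  have : mul χ (kElt (-α)) (mul χ (kElt α) x) = x := by
    rw [← mul_assoc_hall, kElt, elt_mul_kElt, neg_add_cancel]
    exact one_mul_hall χ x
  rw [← this, h, map_zero]

/-- The identity is left cancellable for convolution. -/
lemma eq_zero_of_mulT_map_id_comul (f : ExtHall C →ₗ[ℂ] ExtHall C)
    (hf : ∀ x, mulT χ (TensorProduct.map LinearMap.id f (comul χ x)) = 0) : f = 0 := by
  suffices H : ∀ (n : ℕ) (M : C) (α : K0 C), Fintype.card (Subobject M) < n →
      f (elt (isoClass M) α) = 0 from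
    hom_ext_elt fun M α => H _ M α (Nat.lt_succ_self _)
  intro n
  induction n with
  | zero => exact fun M α h => absurd h (Nat.not_lt_zero _)
  | succ n ih =>
    intro M α hn
    have h := hf (elt (isoClass M) α)
    -- Proper subobjects contribute nothing by induction; the surviving term is f([M] k_α)
    -- multiplied by an invertible k.
    rw [mulT_map_comul_elt, Finset.sum_eq_single (⊤ : Subobject M), isoClass_cokernel_top,
      isoClass_top, comulCoeff_zero_left, one_smul] at h
    · exact eq_zero_of_kElt_mul_eq_zero χ h
    · intro X _ hX
      rw [ih (X : C) α (Nat.lt_of_lt_of_le (card_subobject_lt hX) (Nat.lt_succ_iff.1 hn)),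
        map_zero, smul_zero]
    · simp

end Antipode

/-! ### The Hopf algebra -/

section Ring

variable [HasExt.{w} C]

/-- The extended Hall algebra, as a ring. -/
def HallRing (_ : EulerRoot.{w} C) : Type u := ExtHall C

variable (χ : EulerRoot.{w} C)

instance : AddCommGroup (HallRing χ) := inferInstanceAs (AddCommGroup (ExtHall C))

instance : Module ℂ (HallRing χ) := inferInstanceAs (Module ℂ (ExtHall C))

variable [∀ M N : C, Finite (M ⟶ N)] [∀ M : C, Fintype (Subobject M)]
  [∀ M N : C, Finite (Ext.{w} M N 1)]

instance : Ring (HallRing χ) where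
  __ := (inferInstance : AddCommGroup (HallRing χ))
  mul x y := mul χ x y
  one := one C
  zero_mul x := LinearMap.map_zero₂ (mul χ) x
  mul_zero x := (mul χ x).map_zero
  left_distrib x y z := (mul χ x).map_add y z
  right_distrib x y z := LinearMap.map_add₂ (mul χ) x y z
  one_mul := one_mul_hall χ
  mul_one := mul_one_hall χ
  mul_assoc := mul_assoc_hall χ

instance : Algebra ℂ (HallRing χ) :=
  Algebra.ofModule (fun c x y => LinearMap.map_smul₂ (mul χ) c x y)
    (fun c x y => (mul χ x).map_smul c y)

instance : Coalgebra ℂ (HallRing χ) where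
  comul := comul χ
  counit := counit C
  coassoc := comul_coassoc χ
  rTensor_counit_comp_comul := rTensor_counit_comul χ
  lTensor_counit_comp_comul := lTensor_counit_comul χ

lemma mul'_eq : LinearMap.mul' ℂ (HallRing χ) = mulT χ :=
  TensorProduct.ext' fun _ _ => rfl

/-- The bialgebra structure depends on Green's formula, hence on `C` being hereditary. -/
@[reducible] def bialgebra (hher : IsHereditary.{w} C) : Bialgebra ℂ (HallRing χ) :=
  Bialgebra.mk' ℂ (HallRing χ)
    (by
      have := counit_elt (C := C) (isoClass (0 : C)) 0
      rwa [if_pos rfl] at this)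
    (fun {x y} => counit_mul χ x y)
    (comul_kElt χ 0)
    (fun {x y} => (comul_mul χ hher x y).trans (mul_eq_map₂ (R := ℂ) (A := HallRing χ) _ _).symm)

/-- The antipode, as an endomorphism of the algebra `HallRing χ`. -/
def hallAntipode : HallRing χ →ₗ[ℂ] HallRing χ := antipode χ

open WithConv in
/-- The Hopf algebra structure. -/
@[reducible] def hopfAlgebra (hher : IsHereditary.{w} C) : HopfAlgebra ℂ (HallRing χ) :=
  let _ := bialgebra χ hher
  have h : toConv (LinearMap.id : HallRing χ →ₗ[ℂ] HallRing χ) *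
      toConv (hallAntipode χ) = 1 := by
    have := mulT_map_id_antipode_comul χ
    rw [← mul'_eq] at this
    exact WithConv.ext this
  HopfAlgebra.ofConvInverse (hallAntipode χ)
    (by
      -- From id * S = 1 one gets id * (S * id - 1) = 0, and the identity cancels on the left.
      have h' : toConv (LinearMap.id : HallRing χ →ₗ[ℂ] HallRing χ) *
          (toConv (hallAntipode χ) * toConv LinearMap.id - 1) = 0 := by
        rw [mul_sub, ← mul_assoc, h, one_mul, mul_one, sub_self]
      refine sub_eq_zero.1 (WithConv.ext (eq_zero_of_mulT_map_id_comul χ _ fun x => ?_))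
      rw [← mul'_eq]
      exact LinearMap.congr_fun (congrArg WithConv.ofConv h') x) h

end Ring

end HallAlg

end

/-! ### The theorem -/

theorem mainTheorem5 {C : Type u} [Category.{v} C] [Abelian C] [HasExt.{w} C]
    (hfin : HallAlg.IsFinitary.{w} C) (hher : HallAlg.IsHereditary.{w} C)
    (hsub : HallAlg.FiniteSubobjects C) (χ : HallAlg.EulerRoot.{w} C) :
    -- all sums in the definitions of the product, the coproduct and `S` are finite
    ((∀ M N : HallAlg.IsoClass C, {R | HallAlg.hallP R M N ≠ 0}.Finite) ∧
      (∀ R : HallAlg.IsoClass C,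
        {MN : HallAlg.IsoClass C × HallAlg.IsoClass C |
          HallAlg.hallP R MN.1 MN.2 ≠ 0}.Finite) ∧
      (∀ M : C, Finite (HallAlg.StrictFiltration M))) ∧
    -- `m ∘ (1 ⊗ S) ∘ Δ = i ∘ ε` and `m ∘ (S ⊗ 1) ∘ Δ = i ∘ ε`
    (HallAlg.mulT χ ∘ₗ TensorProduct.map LinearMap.id (HallAlg.antipode χ) ∘ₗ HallAlg.comul χ =
        HallAlg.unit C ∘ₗ HallAlg.counit C ∧
      HallAlg.mulT χ ∘ₗ TensorProduct.map (HallAlg.antipode χ) LinearMap.id ∘ₗ HallAlg.comul χ =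
        HallAlg.unit C ∘ₗ HallAlg.counit C) ∧
    -- `S(xy) = S(y) S(x)` and `Δ ∘ S = (S ⊗ S) ∘ Δᵒᵖ`
    ((∀ x y : HallAlg.ExtHall C, HallAlg.antipode χ (HallAlg.mul χ x y) =
        HallAlg.mul χ (HallAlg.antipode χ y) (HallAlg.antipode χ x)) ∧
      HallAlg.comul χ ∘ₗ HallAlg.antipode χ =
        TensorProduct.map (HallAlg.antipode χ) (HallAlg.antipode χ) ∘ₗ
          (TensorProduct.comm ℂ (HallAlg.ExtHall C) (HallAlg.ExtHall C)).toLinearMap ∘ₗ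
            HallAlg.comul χ) ∧
    -- `S ∘ i = i` and `ε ∘ S = ε`
    (HallAlg.antipode χ ∘ₗ HallAlg.unit C = HallAlg.unit C ∧
      HallAlg.counit C ∘ₗ HallAlg.antipode χ = HallAlg.counit C) ∧
    -- with these maps the extended Hall algebra is a Hopf algebra
    ∃ (B : Type u) (_ : Ring B) (_ : HopfAlgebra ℂ B) (e : HallAlg.ExtHall C ≃ₗ[ℂ] B),
      (∀ x y : HallAlg.ExtHall C, e (HallAlg.mul χ x y) = e x * e y) ∧
      e (HallAlg.one C) = 1 ∧
      (∀ x : HallAlg.ExtHall C, Coalgebra.comul (R := ℂ) (e x) =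
        TensorProduct.map e.toLinearMap e.toLinearMap (HallAlg.comul χ x)) ∧
      (∀ x : HallAlg.ExtHall C, Coalgebra.counit (R := ℂ) (e x) = HallAlg.counit C x) ∧
      (∀ x : HallAlg.ExtHall C,
        HopfAlgebra.antipode ℂ (e x) = e (HallAlg.antipode χ x)) := by
  have := hfin.finite_hom
  have := hfin.finite_ext
  let _ (M : C) : Fintype (Subobject M) := have := hsub M; Fintype.ofFinite _
  -- General Hopf algebra theory now applies; `HallRing χ` is `ExtHall C` by definition and its
  -- operations unfold to the given ones, so results transfer along the identity.
  let _ : HopfAlgebra ℂ (HallAlg.HallRing χ) := HallAlg.hopfAlgebra χ hher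
  refine ⟨⟨fun M N => ?_, fun R => ?_, fun M => HallAlg.StrictFiltration.finite M⟩,
    ⟨HallAlg.mulT_map_id_antipode_comul χ, ?_⟩,
    ⟨HopfAlgebra.antipode_mul_antidistrib (R := ℂ) (A := HallAlg.HallRing χ),
      HopfAlgebra.comul_comp_antipode (R := ℂ) (A := HallAlg.HallRing χ)⟩,
    ⟨?_, HopfAlgebra.counit_comp_antipode (R := ℂ) (A := HallAlg.HallRing χ)⟩,
    HallAlg.HallRing χ, inferInstance, inferInstance, LinearEquiv.refl ℂ (HallAlg.ExtHall C),
    fun _ _ => rfl, rfl, fun x => ?_, fun _ => rfl, fun _ => rfl⟩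
  · simpa only [ne_eq, HallAlg.hallP_ne_zero_iff] using!
      HallAlg.finite_setOf_hallG_ne_zero'.{w} M N
  · simpa only [ne_eq, HallAlg.hallP_ne_zero_iff] using! HallAlg.finite_setOf_hallG_ne_zero R.rep
  · rw [← HallAlg.mul'_eq]
    exact HopfAlgebra.mul_antipode_rTensor_comul (R := ℂ) (A := HallAlg.HallRing χ)
  · refine LinearMap.ext_ring ?_
    have h := HopfAlgebra.antipode_one (R := ℂ) (A := HallAlg.HallRing χ)
    have h1 : HallAlg.unit C 1 = HallAlg.one C := one_smul ℂ _
    rw [LinearMap.comp_apply, h1]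
    exact h
  · exact (LinearMap.congr_fun TensorProduct.map_id _).symm
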